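/- Let $0\le\nu<1$, let $\alpha\in\mathbb C$ with $\operatorname{Re}\alpha>\frac{1-\nu}{2}$, and let $\lambda\in\mathbb C\setminus\{0\}$. For $p,q>0$, $p\ne q$, put $$G(p,q)=\frac1{\Gamma(2\alpha)}\Bigl(\frac{|p^2-q^2|}{2q}\Bigr)^{2\alpha-1}{}_2F_1\Bigl(\alpha+\tfrac{\nu-1}2,\alpha;2\alpha;1-\tfrac{p^2}{q^2}\Bigr),$$ where ${}_2F_1$ is the Gauss hypergeometric function (analytically continued to arguments $\le -1$), and $$K(p,q)=\frac{2q}{|p^2-q^2|}\int_0^1 S_{\alpha,\nu}\Bigl(\frac{z(t)}{\lambda}\Bigr)\frac{dt}{t^{\frac{3-\nu}2}(1-t)^{\frac{1+\nu}2}},\qquad z(t)=\left(\frac{t(1-t)(p^2-q^2)^2}{\bigl(1-(1-\frac{p^2}{q^2})t\bigr)4q^2}\right)^{\alpha},$$ $$S_{\alpha,\nu}(z)=\sum_{k=1}^\infty\frac{z^k}{\Gamma(\alpha k+\frac{\nu-1}2)\,\Gamma(\alpha k-\frac{\nu-1}2)}$$ (a series of Wright/Fox type). The series converges for every $z\in\mathbb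 C$, and the integral defining $K(p,q)$ converges absolutely for all $p,q>0$, $p\neq q$. For $\kappa\ge0$ let $X_\kappa$ be the space of measurable functions $f:(0,\infty)\to\mathbb C$ (modulo equality almost everywhere) with $\int_0^b y^{\kappa}|f(y)|\,dy<\infty$ for every $b>0$. (a) The Bessel fractional integration operator $(B_{0+}^{\nu,\alpha}f)(x)=\int_0^x G(y,x)f(y)\,dy$ maps $X_0$ to itself, and its resolvent $R_\lambda=(B_{0+}^{\nu,\alpha}-\lambda I)^{-1}$ on $X_0$ exists and equals $$R_\lambda f(x)=-\frac1\lambda f(x)-\frac1\lambda\int_0^x K(y,x)f(y)\,dy .$$ (b) The operator $(\widetilde B_{0+}^{\nu,\alpha}f)(x)=\int_0^x G(x,y)f(y)\,dy$ maps $X_\nu$ to itself, and its resolvent $\widetilde R_\lambda=(\widetilde B_{0+}^{\nu,\alpha}-\lambda I)^{-1}$ on $X_\nu$ exists and equals $$\widetilde R_\lambda f(x)=-\frac1\lambda f(x)-\frac1\lambda\int_0^x K(x,y)f(y)\,dy .$$ In both cases the integrals converge absolutely for almost every $x>0$. (c) For $\nu=0$ this is the Hille–Tamarkin–Dzhrbashyan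 formula for the Riemann–Liouville integral of order $2\alpha$: for $0<y<x$, $$G(x,y)=G(y,x)=\frac{(x-y)^{2\alpha-1}}{\Gamma(2\alpha)},\qquad K(x,y)=K(y,x)=\frac1\lambda(x-y)^{2\alpha-1}E_{2\alpha,2\alpha}\Bigl(\frac{(x-y)^{2\alpha}}\lambda\Bigr),$$ where $E_{\beta,\gamma}(z)=\sum_{n\ge0}z^n/\Gamma(\beta n+\gamma)$ is the Mittag-Leffler function. -/

import Mathlib

open MeasureTheory Set Filter

noncomputable section

/-- Gauss' hypergeometric function `₂F₁(a, b; c; z)` for real `z < 1`: the hypergeometric series for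
`|z| < 1`, and its analytic continuation to `z ≤ -1`, given by Pfaff's transformation
`₂F₁(a, b; c; z) = (1 - z)^(-a) ₂F₁(a, c - b; c; z / (z - 1))`, where `z / (z - 1) ∈ [1/2, 1)`. -/
def gaussHyp (a b c : ℂ) (z : ℝ) : ℂ :=
  if |z| < 1 then ordinaryHypergeometric a b c (z : ℂ)
  else ((1 - z : ℝ) : ℂ) ^ (-a) * ordinaryHypergeometric a (c - b) c ((z / (z - 1) : ℝ) : ℂ)

/-- The kernel
`G_{ν,α}(p, q) = Γ(2α)⁻¹ (|p² - q²| / (2q))^(2α - 1) ₂F₁(α + (ν - 1)/2, α; 2α; 1 - p²/q²)`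
of Bessel fractional integration, for `p, q > 0`, `p ≠ q`. -/
def besselFracKernel (ν : ℝ) (α : ℂ) (p q : ℝ) : ℂ :=
  (Complex.Gamma (2 * α))⁻¹ * ((|p ^ 2 - q ^ 2| / (2 * q) : ℝ) : ℂ) ^ (2 * α - 1) *
    gaussHyp (α + ((ν : ℂ) - 1) / 2) α (2 * α) (1 - p ^ 2 / q ^ 2)

/-- The left-sided Bessel fractional integral `B_{a+}^{ν,α}`, with kernel
`Γ(2α)⁻¹ ((x² - y²) / (2x))^(2α - 1) ₂F₁(α + (ν - 1)/2, α; 2α; 1 - y²/x²)` on `a < y < x`. -/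
def besselFracIntLeft (ν : ℝ) (α : ℂ) (a : ℝ) (f : ℝ → ℂ) (x : ℝ) : ℂ :=
  ∫ y in Ioo a x, besselFracKernel ν α y x * f y

/-- The Bessel fractional integral over `(a, x)` whose kernel is
`Γ(2α)⁻¹ ((x² - y²) / (2y))^(2α - 1) ₂F₁(α + (ν - 1)/2, α; 2α; 1 - x²/y²)` on `a < y < x`, that is,
the expression that is the kernel of the right-sided operator on `(x, b)`. -/
def besselFracIntLeft' (ν : ℝ) (α : ℂ) (a : ℝ) (f : ℝ → ℂ) (x : ℝ) : ℂ :=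
  ∫ y in Ioo a x, besselFracKernel ν α x y * f y

/-- The `k`-th term (`k ≥ 1`) of the series `S_{α,ν}(z)`. -/
def besselWrightTerm (α : ℂ) (ν : ℝ) (z : ℂ) (k : ℕ) : ℂ :=
  z ^ k / (Complex.Gamma (α * k + ((ν : ℂ) - 1) / 2) * Complex.Gamma (α * k - ((ν : ℂ) - 1) / 2))

/-- `S_{α,ν}(z) = ∑_{k ≥ 1} z^k / (Γ(αk + (ν - 1)/2) Γ(αk - (ν - 1)/2))`. -/
def besselWright (α : ℂ) (ν : ℝ) (z : ℂ) : ℂ :=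
  ∑' k : ℕ, besselWrightTerm α ν z (k + 1)

/-- `z(t) = (t (1 - t) (p² - q²)² / ((1 - (1 - p²/q²) t) 4q²))^α`. -/
def besselResolventArg (α : ℂ) (p q t : ℝ) : ℂ :=
  ((t * (1 - t) * (p ^ 2 - q ^ 2) ^ 2 / ((1 - (1 - p ^ 2 / q ^ 2) * t) * (4 * q ^ 2)) : ℝ) : ℂ) ^ α

/-- The integrand `S_{α,ν}(z(t) / lam) / (t^((3 - ν)/2) (1 - t)^((1 + ν)/2))`. -/
def besselResolventIntegrand (ν : ℝ) (α lam : ℂ) (p q t : ℝ) : ℂ :=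
  besselWright α ν (besselResolventArg α p q t / lam) /
    ((t ^ ((3 - ν) / 2) * (1 - t) ^ ((1 + ν) / 2) : ℝ) : ℂ)

/-- The resolvent kernel
`K(p, q) = (2q / |p² - q²|) ∫₀¹ S_{α,ν}(z(t) / lam) dt / (t^((3 - ν)/2) (1 - t)^((1 + ν)/2))`. -/
def besselResolventKernel (ν : ℝ) (α lam : ℂ) (p q : ℝ) : ℂ :=
  ((2 * q / |p ^ 2 - q ^ 2| : ℝ) : ℂ) *
    ∫ t in Ioo (0 : ℝ) 1, besselResolventIntegrand ν α lam p q t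

/-- `R f (x) = - f(x) / lam - (1 / lam) ∫₀ˣ K(x, y) f(y) dy`. -/
def resolventForm (lam : ℂ) (K : ℝ → ℝ → ℂ) (f : ℝ → ℂ) (x : ℝ) : ℂ :=
  -(1 / lam) * f x - (1 / lam) * ∫ y in Ioo 0 x, K x y * f y

/-- Functions on the half-line `(0, ∞)` for which `y^κ f(y)` is integrable on every `(0, b)`. -/
def locIntegrableSpace (κ : ℝ) : Set (ℝ → ℂ) :=
  {f | ∀ b : ℝ, 0 < b → IntegrableOn (fun y : ℝ => ((y ^ κ : ℝ) : ℂ) * f y) (Ioo 0 b)}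

/-- `R` is the resolvent `(B - lam)⁻¹` of the operator `B` on the space `X` of functions on
`(0, ∞)` (taken up to equality almost everywhere): `B` and `R` map `X` to itself, and `R` is a
right and a left inverse of `B - lam`. -/
def IsResolventAt (X : Set (ℝ → ℂ)) (B : (ℝ → ℂ) → ℝ → ℂ) (lam : ℂ) (R : (ℝ → ℂ) → ℝ → ℂ) : Prop :=
  (∀ f ∈ X, B f ∈ X) ∧ (∀ f ∈ X, R f ∈ X) ∧
  (∀ f ∈ X, (fun x => B (R f) x - lam * R f x) =ᵐ[volume.restrict (Ioi 0)] f) ∧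
  (∀ f ∈ X, R (fun x => B f x - lam * f x) =ᵐ[volume.restrict (Ioi 0)] f)

/-- The integral `∫₀ˣ G(x, y) f(y) dy` converges absolutely for almost every `x > 0`. -/
def ConvergesAE (G : ℝ → ℝ → ℂ) (f : ℝ → ℂ) : Prop :=
  ∀ᵐ x ∂(volume.restrict (Ioi (0 : ℝ))), IntegrableOn (fun y => G x y * f y) (Ioo 0 x)

/-- The Mittag-Leffler function `E_{β,γ}(z) = ∑_{n ≥ 0} z^n / Γ(βn + γ)`. -/
def mittagLeffler (β γ z : ℂ) : ℂ :=
  ∑' n : ℕ, z ^ n / Complex.Gamma (β * n + γ)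

end

/-! The resolvent is a Neumann series. Bessel fractional integrals form a semigroup in the order, so
formally `(B - lam)⁻¹ = -lam⁻¹ (I + ∑_{k ≥ 1} lam⁻ᵏ Bᵏ)`, where `Bᵏ` is the integral of order `αk`.
The factor `1 / (Γ(αk + (ν - 1)/2) Γ(αk - (ν - 1)/2))` decays so fast that the series converges for
every `lam ≠ 0`.

Two Euler integrals of the same `₂F₁` do the work. With Beta parameter `α + (ν - 1)/2` the order
enters only through a power of the base of `z(t)` and through the Gamma factors
(`besselFracKernel_euler_integral`); summing over `k` under the integral then produces `S_{α,ν}` and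
identifies `K` with the Neumann series for `p < q` (`besselResolventKernel_hasSum`). With Beta
parameter `α` the weight is symmetric under `t ↦ 1 - t`. This shows that `G(p, q)` is `q^ν` times a
symmetric function (`besselFracKernel_eq_symmPart`), and that `G` is a composition of two
Riemann-Liouville kernels in the squared variables with a power weight in between.

The semigroup law is never proved for kernels. Integration of order `β` sends `y^σ` to a multiple of
`x^(σ + 2β)` (`besselFracKernel_moment`), and the multipliers satisfy the cocycle law
`besselMomentCoeff_mul`. Hence the resolvent equations `GK = KG = lam K - G` hold on powers. Both
kernels are bounded by a multiple of `(x - y)^(2 Re α - 1)` on bounded intervals, so they act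
boundedly on `L¹(0, b)`; polynomials are dense there, and the equations extend to all integrable
functions (`resolvent_identities`). Algebra then gives (a).

Part (b) is (a) conjugated by multiplication by `y^ν`. For `G` the intertwining relation is the
symmetry above; for `K` it comes from a Möbius substitution in the defining integral
(`integral_resolvent_swap`). For (c), `G` at `ν = 0` has the same moments as the Riemann-Liouville
kernel, and summing the Neumann series gives the Mittag-Leffler function. -/

/-! ### Binomial series and Euler's integral for `₂F₁`. -/

theorem ascPochhammer_binomial_hasSum (a w : ℂ) (hw : ‖w‖ < 1) :
    HasSum (fun n : ℕ => (n.factorial : ℂ)⁻¹ * (ascPochhammer ℂ n).eval a * w ^ n)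
      ((1 - w) ^ (-a)) := by
  -- The binomial series is read as `₂F₁(a, 1; 1; w)`. The repeated parameter is arbitrary; it must
  -- only avoid the nonpositive integers, so that its Pochhammer symbols cancel.
  have h1 : ∀ k : ℕ, (k : ℂ) ≠ -1 := fun k hk => by
    have := congrArg Complex.re hk
    simp at this
    linarith [(Nat.cast_nonneg k : (0 : ℝ) ≤ k)]
  have h := (Complex.one_add_cpow_hasFPowerSeriesOnBall_zero (a := -a)).hasSum (y := -w)
    (by rw [← ENNReal.ofReal_one, Metric.eball_ofReal]; simpa using hw)
  rw [binomialSeries_eq_ordinaryHypergeometricSeries h1] at h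
  rw [zero_add, ← sub_eq_add_neg] at h
  convert! h using 2 with n
  have h2 : (ascPochhammer ℂ n).eval (1 : ℂ) ≠ 0 := by
    rw [Ne, ascPochhammer_eval_eq_zero_iff]
    rintro ⟨k, -, hk⟩
    exact h1 k hk
  have := ordinaryHypergeometricSeries_apply_eq (𝔸 := ℂ) a 1 1 w n
  simp only [neg_neg, FormalMultilinearSeries.compContinuousLinearMap_apply]
  rw [show (⇑(-ContinuousLinearMap.id ℂ ℂ) ∘ fun _ : Fin n => -w) = fun _ => w by ext; simp, this,
    smul_eq_mul, mul_inv_cancel_right₀ h2]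

theorem ascPochhammer_binomial_summable_norm (a : ℂ) (r : ℝ) (hr0 : 0 ≤ r) (hr : r < 1) :
    Summable fun n : ℕ => ‖(n.factorial : ℂ)⁻¹ * (ascPochhammer ℂ n).eval a‖ * r ^ n := by
  have h := (ascPochhammer_binomial_hasSum a r (by simpa [abs_of_nonneg hr0] using hr)).summable.norm
  refine h.congr fun n => ?_
  rw [norm_mul, norm_pow, Complex.norm_real, Real.norm_of_nonneg hr0]

theorem beta_integrableOn {b c : ℂ} (hb : 0 < b.re) (hc : 0 < c.re) :
    IntegrableOn (fun t : ℝ => (t : ℂ) ^ (b - 1) * (1 - (t : ℂ)) ^ (c - 1)) (Ioo 0 1) :=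
  ((intervalIntegrable_iff_integrableOn_Ioo_of_le zero_le_one).1
    (Complex.betaIntegral_convergent hb hc))

theorem beta_integral_Ioo {b c : ℂ} (hb : 0 < b.re) (hc : 0 < c.re) :
    ∫ t in Ioo (0 : ℝ) 1, (t : ℂ) ^ (b - 1) * (1 - (t : ℂ)) ^ (c - 1) =
      Complex.Gamma b * Complex.Gamma c / Complex.Gamma (b + c) := by
  rw [← Complex.betaIntegral_eq_Gamma_mul_div b c hb hc, Complex.betaIntegral,
    intervalIntegral.integral_of_le zero_le_one, integral_Ioc_eq_integral_Ioo]

theorem ne_neg_nat_of_re_pos {s : ℂ} (hs : 0 < s.re) (k : ℕ) : s ≠ -k := fun h => by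
  rw [h] at hs
  simp at hs
  linarith [(Nat.cast_nonneg k : (0 : ℝ) ≤ k)]

/-- Expand `(1 - zt)^(-a)` in the binomial series and integrate term by term: each term is a Beta
integral. The interchange is justified by `t^n ≤ 1` and absolute convergence at `|z| < 1`. -/
theorem ordinaryHypergeometric_euler_integral (a : ℂ) {b c : ℂ} (hb : 0 < b.re)
    (hcb : 0 < (c - b).re) (z : ℝ) (hz : |z| < 1) :
    ordinaryHypergeometric a b c (z : ℂ) =
      Complex.Gamma c / (Complex.Gamma b * Complex.Gamma (c - b)) *
        ∫ t in Ioo (0 : ℝ) 1, (t : ℂ) ^ (b - 1) * (1 - (t : ℂ)) ^ (c - b - 1) *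
          (1 - (z : ℂ) * t) ^ (-a) := by
  have hc : 0 < c.re := by simp at hcb; linarith
  have hGb := Complex.Gamma_ne_zero_of_re_pos hb
  have hGc := Complex.Gamma_ne_zero_of_re_pos hc
  have hGcb := Complex.Gamma_ne_zero_of_re_pos hcb
  set A : ℕ → ℂ := fun n => (n.factorial : ℂ)⁻¹ * (ascPochhammer ℂ n).eval a with hA
  set F : ℕ → ℝ → ℂ := fun n t => A n * (z : ℂ) ^ n *
    ((t : ℂ) ^ (b + n - 1) * (1 - (t : ℂ)) ^ (c - b - 1)) with hF
  have hbn : ∀ n : ℕ, 0 < (b + n).re := fun n => by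
    simp; linarith [(Nat.cast_nonneg n : (0 : ℝ) ≤ n)]
  have hFint : ∀ n, IntegrableOn (F n) (Ioo 0 1) := fun n =>
    (beta_integrableOn (hbn n) hcb).const_mul _
  have hpow : ∀ n : ℕ, ∀ t ∈ Ioo (0 : ℝ) 1, (t : ℂ) ^ (b + n - 1) = (t : ℂ) ^ (b - 1) * t ^ n := by
    intro n t ht
    have h0 : (t : ℂ) ≠ 0 := by exact_mod_cast ht.1.ne'
    rw [show b + n - 1 = (b - 1) + n by ring, Complex.cpow_add _ _ h0, Complex.cpow_natCast]
  have hsum : Summable fun n => ∫ t in Ioo (0 : ℝ) 1, ‖F n t‖ := by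
    refine Summable.of_nonneg_of_le (fun n => integral_nonneg fun t => norm_nonneg _)
      (fun n => ?_) ((ascPochhammer_binomial_summable_norm a |z| (abs_nonneg z) hz).mul_right
        (∫ t in Ioo (0 : ℝ) 1, ‖(t : ℂ) ^ (b - 1) * (1 - (t : ℂ)) ^ (c - b - 1)‖))
    rw [← integral_const_mul]
    refine setIntegral_mono_on (hFint n).norm ((beta_integrableOn hb hcb).norm.const_mul _)
      measurableSet_Ioo fun t ht => ?_
    simp only [hF]
    rw [hpow n t ht, norm_mul, norm_mul, norm_pow, Complex.norm_real, Real.norm_eq_abs]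
    refine mul_le_mul_of_nonneg_left ?_ (by positivity)
    rw [norm_mul, norm_mul, norm_mul, norm_pow, Complex.norm_real, Real.norm_eq_abs, abs_of_pos ht.1]
    refine mul_le_mul_of_nonneg_right ?_ (norm_nonneg _)
    exact mul_le_of_le_one_right (norm_nonneg _) (pow_le_one₀ ht.1.le ht.2.le)
  have h1 := hasSum_integral_of_summable_integral_norm hFint hsum
  have h2 : ∫ t in Ioo (0 : ℝ) 1, ∑' n, F n t = ∫ t in Ioo (0 : ℝ) 1,
      (t : ℂ) ^ (b - 1) * (1 - (t : ℂ)) ^ (c - b - 1) * (1 - (z : ℂ) * t) ^ (-a) := by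
    refine setIntegral_congr_fun measurableSet_Ioo fun t ht => ?_
    have hw : ‖(z : ℂ) * t‖ < 1 := by
      rw [norm_mul, Complex.norm_real, Complex.norm_real, Real.norm_eq_abs, Real.norm_eq_abs,
        abs_of_pos ht.1]
      exact (mul_le_of_le_one_right (abs_nonneg z) ht.2.le).trans_lt hz
    refine HasSum.tsum_eq ?_
    convert! (ascPochhammer_binomial_hasSum a _ hw).mul_left
      ((t : ℂ) ^ (b - 1) * (1 - (t : ℂ)) ^ (c - b - 1)) using 2 with n
    simp only [hF, hA]
    rw [hpow n t ht, mul_pow]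
    ring
  rw [h2] at h1
  rw [← h1.tsum_eq, ordinaryHypergeometric_eq_tsum, ← tsum_mul_left]
  refine tsum_congr fun n => ?_
  simp only [hF]
  rw [integral_const_mul, beta_integral_Ioo (hbn n) hcb, smul_eq_mul,
    ← Complex.Gamma_add_nat_div_Gamma_eq b (ne_neg_nat_of_re_pos hb),
    ← Complex.Gamma_add_nat_div_Gamma_eq c (ne_neg_nat_of_re_pos hc),
    show b + (n : ℂ) + (c - b) = c + n by ring]
  have hGcn : Complex.Gamma (c + n) ≠ 0 := Complex.Gamma_ne_zero_of_re_pos (by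
    simp; linarith [(Nat.cast_nonneg n : (0 : ℝ) ≤ n)])
  simp only [hA]
  field_simp

theorem ordinaryHypergeometric_comm (a b c z : ℂ) :
    ordinaryHypergeometric a b c z = ordinaryHypergeometric b a c z := by
  rw [ordinaryHypergeometric, ordinaryHypergeometricSeries_symm, ← ordinaryHypergeometric]

theorem ordinaryHypergeometric_continuousOn_ball {a b c : ℂ} (ha : 0 < a.re) (hb : 0 < b.re)
    (hc : 0 < c.re) : ContinuousOn (ordinaryHypergeometric a b c) (Metric.ball (0 : ℂ) 1) := by
  have hr : (ordinaryHypergeometricSeries ℂ a b c).radius = 1 := by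
    refine ordinaryHypergeometricSeries_radius_eq_one ℂ a b c fun k => ?_
    have key : ∀ s : ℂ, 0 < s.re → (k : ℂ) ≠ -s := fun s hs h =>
      ne_neg_nat_of_re_pos hs k (by rw [h, neg_neg])
    exact ⟨key a ha, key b hb, key c hc⟩
  have h := (ordinaryHypergeometricSeries ℂ a b c).hasFPowerSeriesOnBall (by rw [hr]; simp)
  have h2 := h.continuousOn
  rw [hr, ← ENNReal.ofReal_one, Metric.eball_ofReal] at h2
  exact h2

/-! ### Decay of `1/Γ` along arithmetic progressions and convergence of the Wright-type series. -/

/-- A substitute for Stirling's formula. The ratio of consecutive values is the Beta integral `B(αk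
+ s, α) / Γ(α)`, whose integrand carries a factor of modulus `t^(k Re α)`; it tends to zero by
dominated convergence. -/
theorem inv_Gamma_succ_step_le {α s : ℂ} (hα : 0 < α.re) (hs : 0 < s.re) :
    ∃ δ : ℕ → ℝ, Tendsto δ atTop (nhds 0) ∧ ∀ k : ℕ,
      ‖(Complex.Gamma (α * (k + 1 : ℕ) + s))⁻¹‖ ≤ δ k * ‖(Complex.Gamma (α * k + s))⁻¹‖ := by
  set g : ℝ → ℂ := fun t => (t : ℂ) ^ (s - 1) * (1 - (t : ℂ)) ^ (α - 1) with hg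
  have hgi : IntegrableOn g (Ioo 0 1) := beta_integrableOn hs hα
  have hre : ∀ k : ℕ, 0 < (α * k + s).re := fun k => by
    simp; positivity
  refine ⟨fun k => (∫ t in Ioo (0 : ℝ) 1, ‖g t‖ * t ^ (α.re * k)) * ‖(Complex.Gamma α)⁻¹‖, ?_, ?_⟩
  · suffices h : Tendsto (fun k : ℕ => ∫ t in Ioo (0 : ℝ) 1, ‖g t‖ * t ^ (α.re * k)) atTop
        (nhds (∫ t in Ioo (0 : ℝ) 1, (0 : ℝ))) by
      simpa using h.mul_const ‖(Complex.Gamma α)⁻¹‖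
    refine tendsto_integral_of_dominated_convergence (fun t => ‖g t‖) ?_ hgi.norm ?_ ?_
    · intro k
      refine hgi.norm.aestronglyMeasurable.mul (Measurable.aestronglyMeasurable ?_)
      fun_prop
    · intro k
      refine (ae_restrict_iff' measurableSet_Ioo).2 (Eventually.of_forall fun t ht => ?_)
      rw [norm_mul, norm_norm, Real.norm_of_nonneg (Real.rpow_nonneg ht.1.le _)]
      exact mul_le_of_le_one_right (norm_nonneg _)
        (Real.rpow_le_one ht.1.le ht.2.le (by positivity))
    · refine (ae_restrict_iff' measurableSet_Ioo).2 (Eventually.of_forall fun t ht => ?_)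
      rw [show (0 : ℝ) = ‖g t‖ * 0 by simp]
      refine Tendsto.const_mul _ ?_
      have h1 : t ^ α.re < 1 := Real.rpow_lt_one ht.1.le ht.2 hα
      have := tendsto_pow_atTop_nhds_zero_of_lt_one (Real.rpow_nonneg ht.1.le α.re) h1
      refine this.congr fun k => ?_
      rw [Real.rpow_mul ht.1.le, Real.rpow_natCast]
  · intro k
    have hG := Complex.Gamma_ne_zero_of_re_pos (hre k)
    have hGα := Complex.Gamma_ne_zero_of_re_pos hα
    have hb := beta_integral_Ioo (hre k) hα
    have hG2 : Complex.Gamma (α * k + s + α) ≠ 0 :=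
      Complex.Gamma_ne_zero_of_re_pos (by rw [Complex.add_re]; linarith [hre k])
    have hid : (Complex.Gamma (α * (k + 1 : ℕ) + s))⁻¹ =
        (∫ t in Ioo (0 : ℝ) 1, (t : ℂ) ^ (α * k + s - 1) * (1 - (t : ℂ)) ^ (α - 1)) *
          (Complex.Gamma α)⁻¹ * (Complex.Gamma (α * k + s))⁻¹ := by
      rw [hb, show α * (k + 1 : ℕ) + s = α * k + s + α by push_cast; ring]
      field_simp
    rw [hid, norm_mul, norm_mul]
    refine mul_le_mul_of_nonneg_right (mul_le_mul_of_nonneg_right ?_ (norm_nonneg _))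
      (norm_nonneg _)
    refine (norm_integral_le_integral_norm _).trans (le_of_eq ?_)
    refine setIntegral_congr_fun measurableSet_Ioo fun t ht => ?_
    have h0 : (t : ℂ) ≠ 0 := by exact_mod_cast ht.1.ne'
    simp only [hg]
    rw [show α * k + s - 1 = (s - 1) + α * k by ring, Complex.cpow_add _ _ h0, norm_mul, norm_mul,
      norm_mul, Complex.norm_cpow_eq_rpow_re_of_pos ht.1 (α * k)]
    simp
    ring

theorem summable_inv_Gamma_mul_pow {α μ : ℂ} (hα : 0 < α.re) (h1 : 0 < (α + μ).re)
    (h2 : 0 < (α - μ).re) (z : ℂ) :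
    Summable fun k : ℕ => z ^ (k + 1) /
      (Complex.Gamma (α * (k + 1 : ℕ) + μ) * Complex.Gamma (α * (k + 1 : ℕ) - μ)) := by
  obtain ⟨δ, hδ, hδk⟩ := inv_Gamma_succ_step_le hα h1
  obtain ⟨η, hη, hηk⟩ := inv_Gamma_succ_step_le hα h2
  have hlim : Tendsto (fun k => δ k * η k * ‖z‖) atTop (nhds 0) := by
    simpa using (hδ.mul hη).mul_const ‖z‖
  refine summable_of_ratio_norm_eventually_le (r := 1 / 2) (by norm_num) ?_
  filter_upwards [hlim.eventually (gt_mem_nhds (by norm_num : (0 : ℝ) < 1 / 2))] with k hk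
  have e1 : ∀ k : ℕ, α * (k + 1 : ℕ) + μ = α * k + (α + μ) := fun k => by push_cast; ring
  have e2 : ∀ k : ℕ, α * (k + 1 : ℕ) - μ = α * k + (α - μ) := fun k => by push_cast; ring
  rw [e1, e2, e1, e2, pow_succ z (k + 1), div_eq_mul_inv (z ^ (k + 1) * z),
    div_eq_mul_inv (z ^ (k + 1)), mul_inv, mul_inv,
    norm_mul, norm_mul, norm_mul, norm_mul, norm_mul]
  set A := ‖z ^ (k + 1)‖
  have hm := mul_le_mul (hδk k) (hηk k) (norm_nonneg _) ((norm_nonneg _).trans (hδk k))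
  calc A * ‖z‖ * (‖(Complex.Gamma (α * (k + 1 : ℕ) + (α + μ)))⁻¹‖ *
        ‖(Complex.Gamma (α * (k + 1 : ℕ) + (α - μ)))⁻¹‖)
      ≤ A * ‖z‖ * (δ k * ‖(Complex.Gamma (α * k + (α + μ)))⁻¹‖ *
        (η k * ‖(Complex.Gamma (α * k + (α - μ)))⁻¹‖)) :=
        mul_le_mul_of_nonneg_left hm (by positivity)
    _ = δ k * η k * ‖z‖ * (A * (‖(Complex.Gamma (α * k + (α + μ)))⁻¹‖ *
        ‖(Complex.Gamma (α * k + (α - μ)))⁻¹‖)) := by ring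
    _ ≤ 1 / 2 * (A * (‖(Complex.Gamma (α * k + (α + μ)))⁻¹‖ *
        ‖(Complex.Gamma (α * k + (α - μ)))⁻¹‖)) :=
        mul_le_mul_of_nonneg_right hk.le (by positivity)

section

variable {ν : ℝ} {α : ℂ}

theorem re_pos_of_lt (hν1 : ν < 1) (hα : (1 - ν) / 2 < α.re) : 0 < α.re := by linarith

theorem re_add_pos_of_lt (hα : (1 - ν) / 2 < α.re) : 0 < (α + ((ν : ℂ) - 1) / 2).re := by
  have : (((ν : ℂ) - 1) / 2) = (((ν - 1) / 2 : ℝ) : ℂ) := by push_cast; ring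
  rw [this, Complex.add_re, Complex.ofReal_re]; linarith

theorem re_sub_pos_of_lt (hν1 : ν < 1) (hα : (1 - ν) / 2 < α.re) :
    0 < (α - ((ν : ℂ) - 1) / 2).re := by
  have : (((ν : ℂ) - 1) / 2) = (((ν - 1) / 2 : ℝ) : ℂ) := by push_cast; ring
  rw [this, Complex.sub_re, Complex.ofReal_re]; linarith

theorem lt_re_mul_succ (hν1 : ν < 1) (hα : (1 - ν) / 2 < α.re) (k : ℕ) :
    (1 - ν) / 2 < (α * (k + 1 : ℕ)).re := by
  have h := re_pos_of_lt hν1 hα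
  rw [← Complex.ofReal_natCast, Complex.re_mul_ofReal]
  push_cast
  nlinarith [mul_nonneg h.le (Nat.cast_nonneg k : (0 : ℝ) ≤ k)]

theorem besselWrightTerm_summable (hν1 : ν < 1) (hα : (1 - ν) / 2 < α.re) (z : ℂ) :
    Summable fun k : ℕ => besselWrightTerm α ν z (k + 1) :=
  summable_inv_Gamma_mul_pow (re_pos_of_lt hν1 hα) (re_add_pos_of_lt hα)
    (re_sub_pos_of_lt hν1 hα) z

/-- The coefficient `1 / (Γ(β + (ν - 1)/2) Γ(β - (ν - 1)/2))`. -/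
noncomputable def besselCoeff (ν : ℝ) (β : ℂ) : ℂ :=
  (Complex.Gamma (β + ((ν : ℂ) - 1) / 2) * Complex.Gamma (β - ((ν : ℂ) - 1) / 2))⁻¹

theorem besselWrightTerm_eq (z : ℂ) (k : ℕ) :
    besselWrightTerm α ν z k = besselCoeff ν (α * k) * z ^ k := by
  rw [besselWrightTerm, besselCoeff, div_eq_mul_inv, mul_comm]

theorem besselCoeff_summable (hν1 : ν < 1) (hα : (1 - ν) / 2 < α.re) (r : ℝ) (hr : 0 ≤ r) :
    Summable fun k : ℕ => ‖besselCoeff ν (α * (k + 1 : ℕ))‖ * r ^ (k + 1) := by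
  refine (besselWrightTerm_summable hν1 hα (r : ℂ)).norm.congr fun k => ?_
  rw [besselWrightTerm_eq, norm_mul, norm_pow, Complex.norm_real, Real.norm_of_nonneg hr]

end

/-! ### Euler's integral with the symmetric Beta weight and the symmetry of `G`. -/

/-- Used throughout to merge powers of positive bases into one exponential, so that an identity
between them becomes an identity of exponents that `ring` proves. -/
theorem ofReal_cpow_eq_exp {x : ℝ} (hx : 0 < x) (s : ℂ) :
    (x : ℂ) ^ s = Complex.exp (Real.log x * s) := by
  rw [Complex.cpow_def_of_ne_zero (by exact_mod_cast hx.ne'), Complex.ofReal_log hx.le]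

theorem integral_Ioo_comp_one_sub (f : ℝ → ℂ) :
    ∫ t in Ioo (0 : ℝ) 1, f (1 - t) = ∫ t in Ioo (0 : ℝ) 1, f t := by
  have h := intervalIntegral.integral_comp_sub_left (a := 0) (b := 1) f 1
  simpa [intervalIntegral.integral_of_le zero_le_one, integral_Ioc_eq_integral_Ioo] using h

/-- For `c = 2b` one formula covers both branches of `gaussHyp`. Pfaff's transformation leaves the
Beta weight unchanged because `c - b = b`, and `t ↦ 1 - t` turns its last factor into `((1 - zt)/(1
- z))^(-a)`, which absorbs the prefactor `(1 - z)^(-a)`. -/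
theorem gaussHyp_euler_integral (a : ℂ) {b : ℂ} (hb : 0 < b.re) {z : ℝ} (hz : z < 1) :
    gaussHyp a b (2 * b) z = Complex.Gamma (2 * b) / (Complex.Gamma b * Complex.Gamma b) *
      ∫ t in Ioo (0 : ℝ) 1, (t : ℂ) ^ (b - 1) * ((1 - t : ℝ) : ℂ) ^ (b - 1) *
        ((1 - z * t : ℝ) : ℂ) ^ (-a) := by
  have e : 2 * b - b = b := by ring
  unfold gaussHyp
  split_ifs with h
  · rw [ordinaryHypergeometric_euler_integral a hb (by rwa [e]) z h, e]
    push_cast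
    rfl
  · have hz1 : z ≤ -1 := by
      rw [not_lt, le_abs] at h
      rcases h with h | h <;> linarith
    have hw1 : z / (z - 1) < 1 := by rw [div_lt_one_of_neg (by linarith)]; linarith
    have hw0 : 0 ≤ z / (z - 1) := div_nonneg_of_nonpos (by linarith) (by linarith)
    rw [ordinaryHypergeometric_euler_integral a (b := 2 * b - b) (by rwa [e]) (by rwa [e, e]) _
      (by rwa [abs_of_nonneg hw0]), e, e, mul_left_comm, ← integral_const_mul,
      ← integral_Ioo_comp_one_sub]
    congr 1
    refine setIntegral_congr_fun measurableSet_Ioo fun t ht => ?_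
    have h1 : (0 : ℝ) < 1 - z := by linarith
    have h2 : (0 : ℝ) < 1 - z * t := by nlinarith [ht.1]
    have e1 : (1 : ℂ) - ((z / (z - 1) : ℝ) : ℂ) * ((1 - t : ℝ) : ℂ) =
        (((1 - z * t) / (1 - z) : ℝ) : ℂ) := by
      rw [← Complex.ofReal_one, ← Complex.ofReal_mul, ← Complex.ofReal_sub]
      congr 1
      have : z - 1 ≠ 0 := by linarith
      field_simp
      ring
    have e2 : (1 : ℂ) - ((1 - t : ℝ) : ℂ) = (t : ℂ) := by push_cast; ring
    rw [e1, e2, ofReal_cpow_eq_exp h1, ofReal_cpow_eq_exp (div_pos h2 h1), ofReal_cpow_eq_exp h2,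
      Real.log_div h2.ne' h1.ne']
    rw [show ∀ A B C D : ℂ, A * (B * C * D) = C * B * (A * D) by intros; ring, ← Complex.exp_add]
    congr 2
    push_cast
    ring

/-- The symmetric part of the kernel of Bessel fractional integration, as a function of the squares
of its arguments. -/
noncomputable def besselSymmPart (ν : ℝ) (β : ℂ) (P Q : ℝ) : ℂ :=
  (Complex.Gamma β * Complex.Gamma β)⁻¹ * (2 : ℂ) ^ (1 - 2 * β) * ((|P - Q| : ℝ) : ℂ) ^ (2 * β - 1) *
    ∫ t in Ioo (0 : ℝ) 1, (t : ℂ) ^ (β - 1) * ((1 - t : ℝ) : ℂ) ^ (β - 1) *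
      ((Q + (P - Q) * t : ℝ) : ℂ) ^ ((1 - (ν : ℂ)) / 2 - β)

theorem besselSymmPart_comm (ν : ℝ) (β : ℂ) (P Q : ℝ) :
    besselSymmPart ν β P Q = besselSymmPart ν β Q P := by
  unfold besselSymmPart
  rw [abs_sub_comm, ← integral_Ioo_comp_one_sub]
  congr 1
  refine setIntegral_congr_fun measurableSet_Ioo fun t ht => ?_
  rw [show (1 - (1 - t)) = t by ring, show Q + (P - Q) * (1 - t) = P + (Q - P) * t by ring]
  ring

theorem besselFracKernel_eq_symmPart (ν : ℝ) {β : ℂ} (hβ : 0 < β.re) {p q : ℝ} (hp : 0 < p)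
    (hq : 0 < q) (hpq : p ≠ q) :
    besselFracKernel ν β p q = ((q ^ ν : ℝ) : ℂ) * besselSymmPart ν β (p ^ 2) (q ^ 2) := by
  have hA : 0 < |p ^ 2 - q ^ 2| := by
    rw [abs_pos, sub_ne_zero, Ne, sq_eq_sq₀ hp.le hq.le]; exact hpq
  have hz : 1 - p ^ 2 / q ^ 2 < 1 := by have : 0 < p ^ 2 / q ^ 2 := by positivity
                                        linarith
  have hG2 : Complex.Gamma (2 * β) ≠ 0 := Complex.Gamma_ne_zero_of_re_pos (by simpa using hβ)
  unfold besselFracKernel besselSymmPart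
  rw [gaussHyp_euler_integral _ hβ hz]
  rw [show ∀ A B I : ℂ, (Complex.Gamma (2 * β))⁻¹ * A * (Complex.Gamma (2 * β) / B * I) =
    B⁻¹ * (A * I) by intros; field_simp, ← integral_const_mul]
  rw [show ∀ A B C D I : ℂ, A * (B * C * D * I) = B * (A * C * D * I) by intros; ring,
    ← integral_const_mul (((q ^ ν : ℝ) : ℂ) * _ * _)]
  congr 1
  refine setIntegral_congr_fun measurableSet_Ioo fun t ht => ?_
  have hB : 0 < q ^ 2 + (p ^ 2 - q ^ 2) * t := by
    have h1 : 0 < 1 - t := by linarith only [ht.2]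
    nlinarith [mul_pos (pow_pos hp 2) ht.1, mul_pos (pow_pos hq 2) h1]
  have e1 : 1 - (1 - p ^ 2 / q ^ 2) * t = (q ^ 2 + (p ^ 2 - q ^ 2) * t) / q ^ 2 := by
    field_simp; ring
  rw [show (2 : ℂ) = ((2 : ℝ) : ℂ) by norm_num, Complex.ofReal_cpow hq.le, e1,
    ofReal_cpow_eq_exp (div_pos hA (by positivity)),
    ofReal_cpow_eq_exp (div_pos hB (by positivity)), ofReal_cpow_eq_exp hq,
    ofReal_cpow_eq_exp two_pos, ofReal_cpow_eq_exp hA, ofReal_cpow_eq_exp hB,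
    Real.log_div hA.ne' (by positivity), Real.log_div hB.ne' (by positivity),
    Real.log_mul two_ne_zero hq.ne', Real.log_pow]
  rw [show ∀ A B C D : ℂ, A * (B * C * D) = B * C * (A * D) by intros; ring,
    show ∀ A B C D E F : ℂ, A * B * C * (D * E * F) = D * E * (A * B * C * F) by intros; ring]
  simp only [← Complex.exp_add]
  congr 2
  push_cast
  ring

theorem besselFracKernel_symm {ν : ℝ} {β : ℂ} (hβ : 0 < β.re) {p q : ℝ} (hp : 0 < p)
    (hq : 0 < q) (hpq : p ≠ q) :
    besselFracKernel ν β p q * ((p ^ ν : ℝ) : ℂ) = besselFracKernel ν β q p * ((q ^ ν : ℝ) : ℂ) := by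
  rw [besselFracKernel_eq_symmPart ν hβ hp hq hpq, besselFracKernel_eq_symmPart ν hβ hq hp hpq.symm,
    besselSymmPart_comm]
  ring

/-! ### Euler's integral in which the order is the exponent of one power. -/

/-- The real base of the power `z(t)`. -/
noncomputable def resolventBase (p q t : ℝ) : ℝ :=
  t * (1 - t) * (p ^ 2 - q ^ 2) ^ 2 / ((1 - (1 - p ^ 2 / q ^ 2) * t) * (4 * q ^ 2))

theorem resolventBase_denom_pos {p q t : ℝ} (hp : 0 < p) (hq : 0 < q) (ht : t ∈ Ioo (0 : ℝ) 1) :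
    1 - t < 1 - (1 - p ^ 2 / q ^ 2) * t := by
  have : 0 < p ^ 2 / q ^ 2 := by positivity
  nlinarith [ht.1]

theorem resolventBase_pos {p q t : ℝ} (hp : 0 < p) (hq : 0 < q) (hpq : p ≠ q)
    (ht : t ∈ Ioo (0 : ℝ) 1) : 0 < resolventBase p q t := by
  have h1 := resolventBase_denom_pos hp hq ht
  have h2 : 0 < 1 - t := by linarith [ht.2]
  have h3 : 0 < (p ^ 2 - q ^ 2) ^ 2 := by
    have : p ^ 2 - q ^ 2 ≠ 0 := by rw [sub_ne_zero, Ne, sq_eq_sq₀ hp.le hq.le]; exact hpq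
    positivity
  have := ht.1
  unfold resolventBase
  have h4 : 0 < 1 - (1 - p ^ 2 / q ^ 2) * t := h2.trans h1
  positivity

/-- The quotient of `1 - t` by the larger denominator is dropped. The factor `t` is kept because it
is needed for integrability against the weight at `t = 0`. -/
theorem resolventBase_le {p q t : ℝ} (hp : 0 < p) (hq : 0 < q) (ht : t ∈ Ioo (0 : ℝ) 1) :
    resolventBase p q t ≤ t * (|p ^ 2 - q ^ 2| / (2 * q)) ^ 2 := by
  have h1 := resolventBase_denom_pos hp hq ht
  have h2 : 0 < 1 - t := by linarith [ht.2]
  have h4 : 0 < 1 - (1 - p ^ 2 / q ^ 2) * t := h2.trans h1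
  have h0 := ht.1
  unfold resolventBase
  rw [div_pow, sq_abs, mul_pow, div_le_iff₀ (by positivity)]
  have : t * ((p ^ 2 - q ^ 2) ^ 2 / (2 ^ 2 * q ^ 2)) *
      ((1 - (1 - p ^ 2 / q ^ 2) * t) * (4 * q ^ 2)) =
      t * (1 - (1 - p ^ 2 / q ^ 2) * t) * (p ^ 2 - q ^ 2) ^ 2 := by
    generalize 1 - (1 - p ^ 2 / q ^ 2) * t = D
    field_simp
    ring
  rw [this]
  gcongr

/-- The weight of the integral that defines the resolvent kernel. -/
noncomputable def resolventWeight (ν t : ℝ) : ℝ := t ^ ((3 - ν) / 2) * (1 - t) ^ ((1 + ν) / 2)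

theorem resolventWeight_pos (ν : ℝ) {t : ℝ} (ht : t ∈ Ioo (0 : ℝ) 1) : 0 < resolventWeight ν t :=
  mul_pos (Real.rpow_pos_of_pos ht.1 _) (Real.rpow_pos_of_pos (by linarith [ht.2]) _)

theorem besselResolventArg_eq (α : ℂ) (p q t : ℝ) :
    besselResolventArg α p q t = (resolventBase p q t : ℂ) ^ α := rfl

/-- The two upper parameters are exchanged before Euler's integral is applied. All dependence on `β`
then collects into the coefficient and the power `z^β`, while the weight is free of `β`. Positivity
of the Beta parameter is exactly `Re β > (1 - ν)/2`, and `p < q` puts the argument in the unit disc.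
-/
theorem besselFracKernel_euler_integral {ν : ℝ} (hν1 : ν < 1) {β : ℂ}
    (hβ : (1 - ν) / 2 < β.re) {p q : ℝ} (hp : 0 < p) (hpq : p < q) :
    besselFracKernel ν β p q = besselCoeff ν β * ((2 * q / |p ^ 2 - q ^ 2| : ℝ) : ℂ) *
      ∫ t in Ioo (0 : ℝ) 1, (resolventBase p q t : ℂ) ^ β / (resolventWeight ν t : ℂ) := by
  have hq : 0 < q := hp.trans hpq
  have hβ0 : 0 < β.re := re_pos_of_lt hν1 hβ
  have hA : 0 < |p ^ 2 - q ^ 2| := by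
    rw [abs_pos, sub_ne_zero, Ne, sq_eq_sq₀ hp.le hq.le]; exact hpq.ne
  have hr1 : p ^ 2 / q ^ 2 < 1 := by
    rw [div_lt_one (by positivity)]; exact pow_lt_pow_left₀ hpq hp.le two_ne_zero
  have hr0 : 0 < p ^ 2 / q ^ 2 := by positivity
  have hz : |1 - p ^ 2 / q ^ 2| < 1 := by rw [abs_lt]; constructor <;> linarith
  have e2 : 2 * β - (β + ((ν : ℂ) - 1) / 2) = β - ((ν : ℂ) - 1) / 2 := by ring
  have hG2 : Complex.Gamma (2 * β) ≠ 0 := Complex.Gamma_ne_zero_of_re_pos (by simpa using hβ0)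
  unfold besselFracKernel gaussHyp besselCoeff
  rw [if_pos hz, ordinaryHypergeometric_comm,
    ordinaryHypergeometric_euler_integral β (re_add_pos_of_lt hβ)
      (by rw [e2]; exact re_sub_pos_of_lt hν1 hβ) _ hz, e2]
  rw [show ∀ A B I : ℂ, (Complex.Gamma (2 * β))⁻¹ * A * (Complex.Gamma (2 * β) / B * I) =
    B⁻¹ * (A * I) by intros; field_simp, ← integral_const_mul, mul_assoc,
    ← integral_const_mul (((2 * q / |p ^ 2 - q ^ 2| : ℝ)) : ℂ)]
  congr 1
  refine setIntegral_congr_fun measurableSet_Ioo fun t ht => ?_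
  have h1t : 0 < 1 - t := by linarith [ht.2]
  have hD : 0 < 1 - (1 - p ^ 2 / q ^ 2) * t := h1t.trans (resolventBase_denom_pos hp hq ht)
  have hm : 0 < |p ^ 2 - q ^ 2| / (2 * q) := by positivity
  have eB : resolventBase p q t =
      t * (1 - t) * (|p ^ 2 - q ^ 2| / (2 * q)) ^ 2 / (1 - (1 - p ^ 2 / q ^ 2) * t) := by
    unfold resolventBase
    rw [div_pow, sq_abs, mul_pow]
    generalize 1 - (1 - p ^ 2 / q ^ 2) * t = D at *
    field_simp
    norm_num
  have eq1 : (1 : ℂ) - ((1 - p ^ 2 / q ^ 2 : ℝ) : ℂ) * t =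
    ((1 - (1 - p ^ 2 / q ^ 2) * t : ℝ) : ℂ) := by push_cast; ring
  have eq2 : (1 : ℂ) - t = ((1 - t : ℝ) : ℂ) := by push_cast; ring
  have eq3 : 2 * q / |p ^ 2 - q ^ 2| = (|p ^ 2 - q ^ 2| / (2 * q))⁻¹ := by rw [inv_div]
  rw [eq1, eq2, eq3, eB, resolventWeight]
  generalize 1 - (1 - p ^ 2 / q ^ 2) * t = D at *
  generalize |p ^ 2 - q ^ 2| / (2 * q) = m at *
  have ht0 := ht.1
  rw [Complex.ofReal_mul, Complex.ofReal_cpow ht0.le, Complex.ofReal_cpow h1t.le]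
  rw [ofReal_cpow_eq_exp (by positivity : 0 < t * (1 - t) * m ^ 2 / D),
    ofReal_cpow_eq_exp hm, ofReal_cpow_eq_exp ht0, ofReal_cpow_eq_exp h1t, ofReal_cpow_eq_exp hD,
    ofReal_cpow_eq_exp ht0, ofReal_cpow_eq_exp h1t,
    Real.log_div (by positivity) hD.ne', Real.log_mul (by positivity) (by positivity),
    Real.log_mul (by positivity) (by positivity), Real.log_pow]
  have hmexp : ((m⁻¹ : ℝ) : ℂ) = Complex.exp (-Real.log m) := by
    rw [Complex.exp_neg, ← Complex.ofReal_exp, Real.exp_log hm, Complex.ofReal_inv]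
  rw [hmexp]
  simp only [← Complex.exp_add, ← Complex.exp_sub]
  congr 1
  push_cast
  ring

theorem aestronglyMeasurable_of_hasSum {X : Type*} [MeasurableSpace X] {μ : Measure X}
    {F : ℕ → X → ℂ} {f : X → ℂ} (hF : ∀ n, AEStronglyMeasurable (F n) μ)
    (h : ∀ᵐ x ∂μ, HasSum (fun n => F n x) (f x)) : AEStronglyMeasurable f μ := by
  refine aestronglyMeasurable_of_tendsto_ae atTop (f := fun n x => ∑ i ∈ Finset.range n, F i x)
    (fun n => ?_) (h.mono fun x hx => hx.tendsto_sum_nat)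
  exact Finset.aestronglyMeasurable_fun_sum _ fun i _ => hF i

/-- The function is a Beta density with parameters `a - (1 - ν)/2` and `(1 - ν)/2`, both positive.
-/
theorem resolventWeight_majorant_integrableOn {ν : ℝ} (hν1 : ν < 1) {a : ℝ}
    (ha : (1 - ν) / 2 < a) : IntegrableOn (fun t => t ^ a / resolventWeight ν t) (Ioo 0 1) := by
  have h := (beta_integrableOn (b := ((a - (1 - ν) / 2 : ℝ) : ℂ)) (c := (((1 - ν) / 2 : ℝ) : ℂ))
    (by rw [Complex.ofReal_re]; linarith) (by rw [Complex.ofReal_re]; linarith)).norm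
  refine IntegrableOn.congr_fun h (fun t ht => ?_) measurableSet_Ioo
  have h1 : 0 < 1 - t := sub_pos.2 ht.2
  have h0 : 0 < t := ht.1
  have e : (1 : ℂ) - t = ((1 - t : ℝ) : ℂ) := by push_cast; ring
  rw [norm_mul, e, Complex.norm_cpow_eq_rpow_re_of_pos h0, Complex.norm_cpow_eq_rpow_re_of_pos h1,
    resolventWeight, Complex.sub_re, Complex.sub_re, Complex.ofReal_re, Complex.ofReal_re,
    Complex.one_re, div_mul_eq_div_div, ← Real.rpow_sub h0, div_eq_mul_inv (t ^ _),
    ← Real.rpow_neg h1.le]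
  congr 2 <;> ring

/-- Lowering the exponent of `t < 1` from `Re β` to a fixed `a` separates the variables: one
integrable function of `t` serves all orders of the series. -/
theorem norm_resolventBase_cpow_le {ν a : ℝ} {β : ℂ} (ha : 0 < a) (hβ : a ≤ β.re) {p q t : ℝ}
    (hp : 0 < p) (hq : 0 < q) (hpq : p ≠ q) (ht : t ∈ Ioo (0 : ℝ) 1) :
    ‖(resolventBase p q t : ℂ) ^ β / (resolventWeight ν t : ℂ)‖ ≤
      (|p ^ 2 - q ^ 2| / (2 * q)) ^ (2 * β.re) * (t ^ a / resolventWeight ν t) := by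
  have hB := resolventBase_pos hp hq hpq ht
  have hw := resolventWeight_pos ν ht
  have hm : 0 ≤ |p ^ 2 - q ^ 2| / (2 * q) := by positivity
  rw [norm_div, Complex.norm_cpow_eq_rpow_re_of_pos hB, Complex.norm_real,
    Real.norm_of_nonneg hw.le, ← mul_div_assoc]
  refine div_le_div_of_nonneg_right ?_ hw.le
  calc resolventBase p q t ^ β.re ≤ (t * (|p ^ 2 - q ^ 2| / (2 * q)) ^ 2) ^ β.re :=
        Real.rpow_le_rpow hB.le (resolventBase_le hp hq ht) (ha.le.trans hβ)
    _ = (|p ^ 2 - q ^ 2| / (2 * q)) ^ (2 * β.re) * t ^ β.re := by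
        rw [Real.mul_rpow ht.1.le (by positivity), ← Real.rpow_natCast, ← Real.rpow_mul hm,
          mul_comm]
        norm_num
    _ ≤ _ := mul_le_mul_of_nonneg_left
        (Real.rpow_le_rpow_of_exponent_ge ht.1 ht.2.le hβ) (Real.rpow_nonneg hm _)

theorem resolventBase_cpow_integrableOn {ν : ℝ} (hν1 : ν < 1) {β : ℂ}
    (hβ : (1 - ν) / 2 < β.re) {p q : ℝ} (hp : 0 < p) (hq : 0 < q) (hpq : p ≠ q) :
    IntegrableOn (fun t => (resolventBase p q t : ℂ) ^ β / (resolventWeight ν t : ℂ))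
      (Ioo 0 1) := by
  refine Integrable.mono' ((resolventWeight_majorant_integrableOn hν1 hβ).const_mul
    ((|p ^ 2 - q ^ 2| / (2 * q)) ^ (2 * β.re))) ?_ ?_
  · unfold resolventBase resolventWeight
    exact Measurable.aestronglyMeasurable (by fun_prop)
  · exact (ae_restrict_iff' measurableSet_Ioo).2 (Eventually.of_forall fun t ht =>
      norm_resolventBase_cpow_le (re_pos_of_lt hν1 hβ) le_rfl hp hq hpq ht)

/-! ### Expansion of the resolvent kernel in its Neumann series. -/

section

variable {ν : ℝ} {α lam : ℂ}

theorem besselResolventIntegrand_hasSum (hν1 : ν < 1) (hα : (1 - ν) / 2 < α.re) (p q t : ℝ) :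
    HasSum (fun k : ℕ => besselCoeff ν (α * (k + 1 : ℕ)) * (lam ^ (k + 1))⁻¹ *
      ((resolventBase p q t : ℂ) ^ (α * (k + 1 : ℕ)) / (resolventWeight ν t : ℂ)))
      (besselResolventIntegrand ν α lam p q t) := by
  have h := (besselWrightTerm_summable hν1 hα (besselResolventArg α p q t / lam)).hasSum.mul_right
    (resolventWeight ν t : ℂ)⁻¹
  convert! h using 2 with k
  rw [besselWrightTerm_eq, besselResolventArg_eq, div_pow, ← Complex.cpow_mul_nat]
  ring

/-- The norms of the coefficients of the expansion of the resolvent kernel in powers of `r`. -/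
noncomputable def resolventMajorant (ν : ℝ) (α lam : ℂ) (r : ℝ) (k : ℕ) : ℝ :=
  ‖besselCoeff ν (α * (k + 1 : ℕ))‖ * (r ^ (2 * α.re) / ‖lam‖) ^ (k + 1)

theorem resolventMajorant_summable (hν1 : ν < 1) (hα : (1 - ν) / 2 < α.re) {r : ℝ} (hr : 0 ≤ r) :
    Summable (resolventMajorant ν α lam r) :=
  besselCoeff_summable hν1 hα _ (by positivity)

theorem norm_resolvent_term_le (hν1 : ν < 1) (hα : (1 - ν) / 2 < α.re) {p q t : ℝ} (hp : 0 < p)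
    (hq : 0 < q) (hpq : p ≠ q) (ht : t ∈ Ioo (0 : ℝ) 1) (k : ℕ) :
    ‖besselCoeff ν (α * (k + 1 : ℕ)) * (lam ^ (k + 1))⁻¹ *
      ((resolventBase p q t : ℂ) ^ (α * (k + 1 : ℕ)) / (resolventWeight ν t : ℂ))‖ ≤
    resolventMajorant ν α lam (|p ^ 2 - q ^ 2| / (2 * q)) k *
      (t ^ α.re / resolventWeight ν t) := by
  have h0 := re_pos_of_lt hν1 hα
  have hre : (α * (k + 1 : ℕ)).re = α.re * (k + 1 : ℕ) := by
    rw [← Complex.ofReal_natCast, Complex.re_mul_ofReal]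
  have h := norm_resolventBase_cpow_le (ν := ν) (a := α.re) (β := α * (k + 1 : ℕ)) h0
    (by rw [hre]; push_cast; nlinarith [mul_nonneg h0.le (Nat.cast_nonneg k : (0 : ℝ) ≤ k)])
    hp hq hpq ht
  rw [hre, ← mul_assoc, Real.rpow_mul (by positivity), Real.rpow_natCast] at h
  rw [norm_mul, norm_mul, norm_inv, norm_pow, resolventMajorant, div_pow]
  calc _ ≤ ‖besselCoeff ν (α * (k + 1 : ℕ))‖ * (‖lam‖ ^ (k + 1))⁻¹ * _ :=
        mul_le_mul_of_nonneg_left h (by positivity)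
    _ = _ := by ring

theorem besselResolventIntegrand_integrableOn (hν1 : ν < 1) (hα : (1 - ν) / 2 < α.re) {p q : ℝ}
    (hp : 0 < p) (hq : 0 < q) (hpq : p ≠ q) :
    IntegrableOn (besselResolventIntegrand ν α lam p q) (Ioo 0 1) := by
  have hm : 0 ≤ |p ^ 2 - q ^ 2| / (2 * q) := by positivity
  refine Integrable.mono' ((resolventWeight_majorant_integrableOn hν1 hα).const_mul
    (∑' k, resolventMajorant ν α lam (|p ^ 2 - q ^ 2| / (2 * q)) k)) ?_ ?_
  · refine aestronglyMeasurable_of_hasSum (fun k => ?_)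
      (Eventually.of_forall fun t => besselResolventIntegrand_hasSum hν1 hα p q t)
    exact ((resolventBase_cpow_integrableOn hν1 (lt_re_mul_succ hν1 hα k)
      hp hq hpq).aestronglyMeasurable).const_mul _
  · refine (ae_restrict_iff' measurableSet_Ioo).2 (Eventually.of_forall fun t ht => ?_)
    rw [← (besselResolventIntegrand_hasSum hν1 hα p q t).tsum_eq, ← tsum_mul_right]
    exact tsum_of_norm_bounded ((resolventMajorant_summable hν1 hα hm).mul_right _).hasSum
      fun k => norm_resolvent_term_le hν1 hα hp hq hpq ht k

/-- The `k`-th term of the Neumann series of the resolvent kernel. -/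
noncomputable def neumannTerm (ν : ℝ) (α lam : ℂ) (k : ℕ) (p q : ℝ) : ℂ :=
  (lam ^ (k + 1))⁻¹ * besselFracKernel ν (α * (k + 1 : ℕ)) p q

theorem neumannTerm_eq (hν1 : ν < 1) (hα : (1 - ν) / 2 < α.re) {p q : ℝ} (hp : 0 < p)
    (hpq : p < q) (k : ℕ) :
    neumannTerm ν α lam k p q = ((2 * q / |p ^ 2 - q ^ 2| : ℝ) : ℂ) * ∫ t in Ioo (0 : ℝ) 1,
      besselCoeff ν (α * (k + 1 : ℕ)) * (lam ^ (k + 1))⁻¹ *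
      ((resolventBase p q t : ℂ) ^ (α * (k + 1 : ℕ)) / (resolventWeight ν t : ℂ)) := by
  rw [neumannTerm, besselFracKernel_euler_integral hν1 (lt_re_mul_succ hν1 hα k) hp hpq,
    integral_const_mul]
  ring

theorem integral_norm_resolvent_term_le (hν1 : ν < 1) (hα : (1 - ν) / 2 < α.re) {p q : ℝ}
    (hp : 0 < p) (hq : 0 < q) (hpq : p ≠ q) (k : ℕ) :
    ∫ t in Ioo (0 : ℝ) 1, ‖besselCoeff ν (α * (k + 1 : ℕ)) * (lam ^ (k + 1))⁻¹ *
      ((resolventBase p q t : ℂ) ^ (α * (k + 1 : ℕ)) / (resolventWeight ν t : ℂ))‖ ≤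
    resolventMajorant ν α lam (|p ^ 2 - q ^ 2| / (2 * q)) k *
      ∫ t in Ioo (0 : ℝ) 1, t ^ α.re / resolventWeight ν t := by
  rw [← integral_const_mul]
  exact setIntegral_mono_on ((resolventBase_cpow_integrableOn hν1 (lt_re_mul_succ hν1 hα k)
      hp hq hpq).const_mul _).norm ((resolventWeight_majorant_integrableOn hν1 hα).const_mul _)
      measurableSet_Ioo fun t ht => norm_resolvent_term_le hν1 hα hp hq hpq ht k

/-- Termwise integration of the Wright series, justified by the summable majorant. Only `p < q` is
treated; the other case is reached later through the symmetry of `K`. -/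
theorem besselResolventKernel_hasSum (hν1 : ν < 1) (hα : (1 - ν) / 2 < α.re) {p q : ℝ}
    (hp : 0 < p) (hpq : p < q) :
    HasSum (fun k => neumannTerm ν α lam k p q) (besselResolventKernel ν α lam p q) := by
  have hq := hp.trans hpq
  have hm : 0 ≤ |p ^ 2 - q ^ 2| / (2 * q) := by positivity
  have h := hasSum_integral_of_summable_integral_norm (μ := volume.restrict (Ioo (0 : ℝ) 1))
    (F := fun k t => besselCoeff ν (α * (k + 1 : ℕ)) * (lam ^ (k + 1))⁻¹ *
      ((resolventBase p q t : ℂ) ^ (α * (k + 1 : ℕ)) / (resolventWeight ν t : ℂ)))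
    (fun k => (resolventBase_cpow_integrableOn hν1 (lt_re_mul_succ hν1 hα k)
      hp hq hpq.ne).const_mul _)
    (Summable.of_nonneg_of_le (fun k => integral_nonneg fun t => norm_nonneg _)
      (fun k => integral_norm_resolvent_term_le hν1 hα hp hq hpq.ne k)
      ((resolventMajorant_summable hν1 hα hm).mul_right _))
  simp_rw [(besselResolventIntegrand_hasSum hν1 hα p q _).tsum_eq] at h
  have h' := h.mul_left ((2 * q / |p ^ 2 - q ^ 2| : ℝ) : ℂ)
  simp_rw [neumannTerm_eq hν1 hα hp hpq]
  exact h'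

/-- The base is `x - y` times `(x + y)/(2x)`, which lies in `(1/2, 1)`. Since `e > -1`, the loss
`2^(-e)` for negative `e` is at most `2`. -/
theorem rpow_half_difference_le {e x y : ℝ} (he : -1 < e) (hy : 0 < y) (hyx : y < x) :
    (|y ^ 2 - x ^ 2| / (2 * x)) ^ e ≤ 2 * (x - y) ^ e := by
  have hx := hy.trans hyx
  have h1 : |y ^ 2 - x ^ 2| / (2 * x) ≤ x - y := by
    rw [abs_of_neg (by nlinarith), div_le_iff₀ (by positivity)]; nlinarith
  have h2 : (x - y) / 2 ≤ |y ^ 2 - x ^ 2| / (2 * x) := by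
    rw [abs_of_neg (by nlinarith), le_div_iff₀ (by positivity)]; nlinarith
  have h3 : 0 < (x - y) / 2 := by linarith
  have h4 : 0 ≤ (x - y) ^ e := Real.rpow_nonneg (by linarith) _
  rcases le_or_gt 0 e with h | h
  · exact (Real.rpow_le_rpow (by positivity) h1 h).trans (by linarith)
  · refine (Real.rpow_le_rpow_of_nonpos h3 h2 h.le).trans ?_
    rw [Real.div_rpow (by linarith) two_pos.le, div_eq_mul_inv, ← Real.rpow_neg two_pos.le, mul_comm]
    refine mul_le_mul_of_nonneg_right ?_ h4
    calc (2 : ℝ) ^ (-e) ≤ 2 ^ (1 : ℝ) := Real.rpow_le_rpow_of_exponent_le one_le_two (by linarith)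
      _ = 2 := Real.rpow_one 2

/-- Every term has the same singularity on the diagonal: of `m⁻¹ m^(2(k+1) Re α)` the part `m^(2 Re
α - 1)` is singular at worst, and the remaining `m^(2k Re α)` is bounded through `m ≤ b`.
Summability of the constants makes the bound pass to `K`. -/
theorem neumannTerm_bound (hν1 : ν < 1) (hα : (1 - ν) / 2 < α.re) {b : ℝ}
    (hb : 0 < b) : ∃ d : ℕ → ℝ, Summable d ∧ (∀ k, 0 ≤ d k) ∧
      ∀ k y x, 0 < y → y < x → x < b →
        ‖neumannTerm ν α lam k y x‖ ≤ d k * (x - y) ^ (2 * α.re - 1) := by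
  set I₀ := ∫ t in Ioo (0 : ℝ) 1, t ^ α.re / resolventWeight ν t with hI₀
  have hI : 0 ≤ I₀ := setIntegral_nonneg measurableSet_Ioo fun t ht =>
    div_nonneg (Real.rpow_nonneg ht.1.le _) (resolventWeight_pos ν ht).le
  have h0 := re_pos_of_lt hν1 hα
  have hM : ∀ k, 0 ≤ resolventMajorant ν α lam b k := fun k => by
    unfold resolventMajorant; positivity
  refine ⟨fun k => (b ^ (2 * α.re))⁻¹ * resolventMajorant ν α lam b k * (2 * I₀),
    ((resolventMajorant_summable hν1 hα hb.le).mul_left _).mul_right _,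
    fun k => by have := hM k; positivity, ?_⟩
  intro k y x hy hyx hxb
  have hx := hy.trans hyx
  set m := |y ^ 2 - x ^ 2| / (2 * x) with hm_def
  have hA : 0 < |y ^ 2 - x ^ 2| := by
    rw [abs_pos, sub_ne_zero, Ne, sq_eq_sq₀ hy.le hx.le]; exact hyx.ne
  have hm : 0 < m := by positivity
  have hmb : m ≤ b := by
    have : m ≤ x - y := by
      rw [hm_def, abs_of_neg (by nlinarith), div_le_iff₀ (by positivity)]; nlinarith
    linarith
  have e1 : 2 * x / |y ^ 2 - x ^ 2| = m⁻¹ := by rw [hm_def, inv_div]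
  rw [neumannTerm_eq hν1 hα hy hyx, norm_mul, Complex.norm_real, e1,
    Real.norm_of_nonneg (by positivity)]
  have h1 := (norm_integral_le_integral_norm _).trans
    (integral_norm_resolvent_term_le (lam := lam) hν1 hα hy hx hyx.ne k)
  refine (mul_le_mul_of_nonneg_left h1 (by positivity)).trans ?_
  rw [← hm_def, ← hI₀]
  have hpow : m ^ (2 * α.re) ≤ b ^ (2 * α.re) := Real.rpow_le_rpow hm.le hmb (by positivity)
  have hmp : 0 < m ^ (2 * α.re) := Real.rpow_pos_of_pos hm _
  have hbp : 0 < b ^ (2 * α.re) := Real.rpow_pos_of_pos hb _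
  have e2 : m⁻¹ * m ^ (2 * α.re) = m ^ (2 * α.re - 1) := by
    rw [Real.rpow_sub_one hm.ne', div_eq_mul_inv, mul_comm]
  have hfin := rpow_half_difference_le (e := 2 * α.re - 1) (by linarith) hy hyx
  rw [← hm_def] at hfin
  unfold resolventMajorant
  calc m⁻¹ * (‖besselCoeff ν (α * (k + 1 : ℕ))‖ * (m ^ (2 * α.re) / ‖lam‖) ^ (k + 1) * I₀)
      = ‖besselCoeff ν (α * (k + 1 : ℕ))‖ * I₀ * (‖lam‖ ^ (k + 1))⁻¹ *
          ((m ^ (2 * α.re)) ^ k * (m⁻¹ * m ^ (2 * α.re))) := by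
        rw [div_pow, pow_succ (m ^ _)]; ring
    _ ≤ ‖besselCoeff ν (α * (k + 1 : ℕ))‖ * I₀ * (‖lam‖ ^ (k + 1))⁻¹ *
          ((b ^ (2 * α.re)) ^ k * (2 * (x - y) ^ (2 * α.re - 1))) := by
        rw [e2]; gcongr
    _ = _ := by
        beta_reduce
        rw [div_pow, pow_succ (b ^ _)]
        field_simp

end

/-! ### Beta integrals and the action of Bessel fractional integration on powers. -/

theorem scaled_beta_integrableOn {u v : ℂ} (hu : 0 < u.re) (hv : 0 < v.re) {S : ℝ} (hS : 0 < S) :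
    IntegrableOn (fun y : ℝ => (y : ℂ) ^ (u - 1) * ((S - y : ℝ) : ℂ) ^ (v - 1)) (Ioo 0 S) := by
  have h := (Complex.betaIntegral_convergent hu hv).comp_mul_left (c := S⁻¹)
  rw [zero_div, one_div, inv_inv, intervalIntegrable_iff_integrableOn_Ioo_of_le hS.le] at h
  refine IntegrableOn.congr_fun (h.const_mul ((S : ℂ) ^ (u - 1) * (S : ℂ) ^ (v - 1)))
    (fun y hy => ?_) measurableSet_Ioo
  have h1 : 0 < S - y := sub_pos.2 hy.2
  have h0 : 0 < y := hy.1
  have e1 : (1 : ℂ) - ((S⁻¹ * y : ℝ) : ℂ) = (((S - y) / S : ℝ) : ℂ) := by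
    rw [← Complex.ofReal_one, ← Complex.ofReal_sub]
    congr 1
    field_simp
  rw [e1, inv_mul_eq_div, ofReal_cpow_eq_exp hS, ofReal_cpow_eq_exp hS,
    ofReal_cpow_eq_exp (div_pos h0 hS), ofReal_cpow_eq_exp (div_pos h1 hS),
    ofReal_cpow_eq_exp h0, ofReal_cpow_eq_exp h1, Real.log_div h0.ne' hS.ne',
    Real.log_div h1.ne' hS.ne']
  simp only [← Complex.exp_add]
  congr 1
  push_cast
  ring

theorem scaled_beta_integral {u v : ℂ} (hu : 0 < u.re) (hv : 0 < v.re) {S : ℝ} (hS : 0 < S) :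
    ∫ y in Ioo 0 S, (y : ℂ) ^ (u - 1) * ((S - y : ℝ) : ℂ) ^ (v - 1) =
      (S : ℂ) ^ (u + v - 1) * (Complex.Gamma u * Complex.Gamma v / Complex.Gamma (u + v)) := by
  rw [← Complex.betaIntegral_eq_Gamma_mul_div u v hu hv, ← Complex.betaIntegral_scaled u v hS,
    intervalIntegral.integral_of_le hS.le, integral_Ioc_eq_integral_Ioo]
  push_cast
  rfl

/-- Passing to moduli replaces the exponents by their real parts. The point is that `C` does not
depend on `S`. -/
theorem scaled_beta_integral_norm {u v : ℂ} (hu : 0 < u.re) (hv : 0 < v.re) :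
    ∃ C : ℝ, ∀ S : ℝ, 0 < S →
    ∫ y in Ioo 0 S, ‖(y : ℂ) ^ (u - 1) * ((S - y : ℝ) : ℂ) ^ (v - 1)‖ =
      C * ‖(S : ℂ) ^ (u + v - 1)‖ := by
  refine ⟨‖Complex.Gamma (u.re : ℂ) * Complex.Gamma (v.re : ℂ) /
    Complex.Gamma ((u.re : ℂ) + v.re)‖, fun S hS => ?_⟩
  have h := scaled_beta_integral (u := (u.re : ℂ)) (v := (v.re : ℂ)) hu hv hS
  have e : ∫ y in Ioo 0 S, (y : ℂ) ^ ((u.re : ℂ) - 1) * ((S - y : ℝ) : ℂ) ^ ((v.re : ℂ) - 1) =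
      ((∫ y in Ioo 0 S, ‖(y : ℂ) ^ (u - 1) * ((S - y : ℝ) : ℂ) ^ (v - 1)‖ : ℝ) : ℂ) := by
    rw [← integral_complex_ofReal]
    refine setIntegral_congr_fun measurableSet_Ioo fun y hy => ?_
    have h1 : 0 < S - y := sub_pos.2 hy.2
    simp only [norm_mul, Complex.norm_cpow_eq_rpow_re_of_pos h1,
      Complex.norm_cpow_eq_rpow_re_of_pos hy.1, Complex.ofReal_mul,
      Complex.ofReal_cpow h1.le, Complex.ofReal_cpow hy.1.le, Complex.sub_re, Complex.one_re]
    push_cast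
    rfl
  rw [e] at h
  have h2 := congrArg norm h
  rw [Complex.norm_real, Real.norm_of_nonneg (integral_nonneg fun _ => norm_nonneg _)] at h2
  rw [h2, norm_mul, mul_comm, Complex.norm_cpow_eq_rpow_re_of_pos hS,
    Complex.norm_cpow_eq_rpow_re_of_pos hS]
  simp

/-- Fubini on the triangle `0 < Y < S < X`. The inner integral over `Y` is a Beta integral
proportional to `S^(τ + β - 1)`, and the outer one over `S` is again a Beta integral. -/
theorem iterated_beta_integral {τ β κ : ℂ} (hτ : 0 < τ.re) (hβ : 0 < β.re)
    (hκ : 0 < (τ + β + κ).re) {X : ℝ} (hX : 0 < X) :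
    ∫ Y in Ioo 0 X, (Y : ℂ) ^ (τ - 1) * ∫ S in Ioo Y X,
      ((X - S : ℝ) : ℂ) ^ (β - 1) * ((S - Y : ℝ) : ℂ) ^ (β - 1) * (S : ℂ) ^ κ =
    (X : ℂ) ^ (τ + β + κ + β - 1) *
      (Complex.Gamma τ * Complex.Gamma β / Complex.Gamma (τ + β)) *
      (Complex.Gamma (τ + β + κ) * Complex.Gamma β / Complex.Gamma (τ + β + κ + β)) := by
  set F : ℝ → ℝ → ℂ := fun Y S => (Ioi Y).indicator (fun S => ((X - S : ℝ) : ℂ) ^ (β - 1) *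
    (S : ℂ) ^ κ * ((Y : ℂ) ^ (τ - 1) * ((S - Y : ℝ) : ℂ) ^ (β - 1))) S with hF
  have hF' : ∀ S, (fun Y => F Y S) = (Iio S).indicator (fun Y => ((X - S : ℝ) : ℂ) ^ (β - 1) *
    (S : ℂ) ^ κ * ((Y : ℂ) ^ (τ - 1) * ((S - Y : ℝ) : ℂ) ^ (β - 1))) := by
    intro S; ext Y; simp only [hF, indicator, mem_Ioi, mem_Iio]
  have hinter : ∀ S ∈ Ioo 0 X, Ioo 0 X ∩ Iio S = Ioo 0 S := by
    intro S hS; ext y; simp only [mem_inter_iff, mem_Ioo, mem_Iio]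
    constructor
    · rintro ⟨⟨a, -⟩, b⟩; exact ⟨a, b⟩
    · rintro ⟨a, b⟩; exact ⟨⟨a, b.trans hS.2⟩, b⟩
  have hmeas : AEStronglyMeasurable (Function.uncurry F)
      ((volume.restrict (Ioo 0 X)).prod (volume.restrict (Ioo 0 X))) := by
    have : Function.uncurry F = {p : ℝ × ℝ | p.1 < p.2}.indicator (fun p =>
        ((X - p.2 : ℝ) : ℂ) ^ (β - 1) * (p.2 : ℂ) ^ κ *
          ((p.1 : ℂ) ^ (τ - 1) * ((p.2 - p.1 : ℝ) : ℂ) ^ (β - 1))) := by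
      ext p; simp only [hF, Function.uncurry, indicator, mem_Ioi, mem_ofPred_eq]
    rw [this]
    refine (Measurable.indicator ?_ (measurableSet_lt measurable_fst
      measurable_snd)).aestronglyMeasurable
    fun_prop
  obtain ⟨C, hC⟩ := scaled_beta_integral_norm hτ hβ
  have hint : Integrable (Function.uncurry F)
      ((volume.restrict (Ioo 0 X)).prod (volume.restrict (Ioo 0 X))) := by
    rw [integrable_prod_iff' hmeas]
    constructor
    · refine (ae_restrict_iff' measurableSet_Ioo).2 (Eventually.of_forall fun S hS => ?_)
      change Integrable (fun Y => F Y S) _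
      rw [hF', integrable_indicator_iff measurableSet_Iio, IntegrableOn,
        Measure.restrict_restrict measurableSet_Iio, inter_comm, hinter S hS]
      exact (scaled_beta_integrableOn hτ hβ hS.1).const_mul _
    · refine IntegrableOn.congr_fun
        ((scaled_beta_integrableOn hκ hβ hX).norm.const_mul C) (fun S hS => ?_) measurableSet_Ioo
      have h1 : 0 < X - S := sub_pos.2 hS.2
      change _ = ∫ Y in Ioo 0 X, ‖F Y S‖
      have : (fun Y => ‖F Y S‖) = (Iio S).indicator (fun Y => ‖((X - S : ℝ) : ℂ) ^ (β - 1) *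
          (S : ℂ) ^ κ‖ * ‖(Y : ℂ) ^ (τ - 1) * ((S - Y : ℝ) : ℂ) ^ (β - 1)‖) := by
        ext Y
        rw [show F Y S = (fun Y => F Y S) Y from rfl, hF', norm_indicator_eq_indicator_norm]
        simp only [norm_mul]
      rw [this, setIntegral_indicator measurableSet_Iio, hinter S hS, integral_const_mul,
        hC S hS.1, show τ + β + κ - 1 = κ + (τ + β - 1) by ring,
        Complex.cpow_add _ _ (by exact_mod_cast hS.1.ne')]
      simp only [norm_mul]
      ring
  have hswap := integral_integral_swap hint
  have hL : ∫ Y in Ioo 0 X, (Y : ℂ) ^ (τ - 1) * ∫ S in Ioo Y X,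
      ((X - S : ℝ) : ℂ) ^ (β - 1) * ((S - Y : ℝ) : ℂ) ^ (β - 1) * (S : ℂ) ^ κ =
      ∫ Y in Ioo 0 X, ∫ S in Ioo 0 X, F Y S := by
    refine setIntegral_congr_fun measurableSet_Ioo fun Y hY => ?_
    have hi : Ioo 0 X ∩ Ioi Y = Ioo Y X := by
      ext y; simp only [mem_inter_iff, mem_Ioo, mem_Ioi]
      constructor
      · rintro ⟨⟨-, a⟩, b⟩; exact ⟨b, a⟩
      · rintro ⟨a, b⟩; exact ⟨⟨hY.1.trans a, b⟩, a⟩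
    simp only [hF]
    rw [setIntegral_indicator measurableSet_Ioi, hi, ← integral_const_mul]
    refine setIntegral_congr_fun measurableSet_Ioo fun S hS => ?_
    ring
  rw [hL, hswap]
  have hR : ∫ S in Ioo 0 X, ∫ Y in Ioo 0 X, F Y S = ∫ S in Ioo 0 X,
      (Complex.Gamma τ * Complex.Gamma β / Complex.Gamma (τ + β)) *
        ((S : ℂ) ^ (τ + β + κ - 1) * ((X - S : ℝ) : ℂ) ^ (β - 1)) := by
    refine setIntegral_congr_fun measurableSet_Ioo fun S hS => ?_
    rw [hF', setIntegral_indicator measurableSet_Iio, hinter S hS, integral_const_mul,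
      scaled_beta_integral hτ hβ hS.1, show τ + β + κ - 1 = κ + (τ + β - 1) by ring,
      Complex.cpow_add _ _ (by exact_mod_cast hS.1.ne')]
    ring
  rw [hR, integral_const_mul, scaled_beta_integral hκ hβ hX]
  ring

theorem integral_Ioo_comp_affine {X Y : ℝ} (hYX : Y < X) (g : ℝ → ℂ) :
    ∫ t in Ioo (0 : ℝ) 1, g (X + (Y - X) * t) = ((X - Y : ℝ) : ℂ)⁻¹ * ∫ S in Ioo Y X, g S := by
  have h := intervalIntegral.integral_comp_add_mul (a := 0) (b := 1) g
    (c := Y - X) (by linarith) X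
  rw [intervalIntegral.integral_of_le zero_le_one, integral_Ioc_eq_integral_Ioo] at h
  rw [h, intervalIntegral.integral_symm, mul_zero, add_zero, mul_one, add_sub_cancel,
    intervalIntegral.integral_of_le hYX.le, integral_Ioc_eq_integral_Ioo, smul_neg, ← neg_smul,
    ← inv_neg, neg_sub, Complex.real_smul, Complex.ofReal_inv]

/-- The substitution `S = X + (Y - X) t` exhibits the kernel as two Riemann-Liouville kernels of
order `β` with a power of `S` between them. -/
theorem besselSymmPart_eq_integral (ν : ℝ) (β : ℂ) {X Y : ℝ} (hYX : Y < X) :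
    besselSymmPart ν β Y X = (Complex.Gamma β * Complex.Gamma β)⁻¹ * (2 : ℂ) ^ (1 - 2 * β) *
      ∫ S in Ioo Y X, ((X - S : ℝ) : ℂ) ^ (β - 1) * ((S - Y : ℝ) : ℂ) ^ (β - 1) *
        (S : ℂ) ^ ((1 - (ν : ℂ)) / 2 - β) := by
  have hd : 0 < X - Y := sub_pos.2 hYX
  have hdc : ((X - Y : ℝ) : ℂ) ≠ 0 := by exact_mod_cast hd.ne'
  have h := integral_Ioo_comp_affine hYX (fun S => ((X - S : ℝ) : ℂ) ^ (β - 1) *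
    ((S - Y : ℝ) : ℂ) ^ (β - 1) * (S : ℂ) ^ ((1 - (ν : ℂ)) / 2 - β))
  rw [eq_inv_mul_iff_mul_eq₀ hdc] at h
  rw [besselSymmPart, ← h, abs_of_neg (by linarith), neg_sub, mul_assoc]
  congr 1
  rw [← integral_const_mul, ← integral_const_mul]
  refine setIntegral_congr_fun measurableSet_Ioo fun t ht => ?_
  have h1t : 0 < 1 - t := sub_pos.2 ht.2
  have e1 : X - (X + (Y - X) * t) = (X - Y) * t := by ring
  have e2 : X + (Y - X) * t - Y = (X - Y) * (1 - t) := by ring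
  have hexp : ((X - Y : ℝ) : ℂ) = Complex.exp (Real.log (X - Y)) := by
    rw [← Complex.ofReal_exp, Real.exp_log hd]
  rw [e1, e2, ofReal_cpow_eq_exp (mul_pos hd ht.1), ofReal_cpow_eq_exp (mul_pos hd h1t),
    ofReal_cpow_eq_exp hd, ofReal_cpow_eq_exp ht.1, ofReal_cpow_eq_exp h1t,
    Real.log_mul hd.ne' ht.1.ne', Real.log_mul hd.ne' h1t.ne', hexp]
  simp only [← mul_assoc, ← Complex.exp_add]
  congr 2
  push_cast
  ring

theorem integral_Ioo_comp_sq {x : ℝ} (hx : 0 < x) (g : ℝ → ℂ) :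
    ∫ y in Ioo 0 x, ((2 * y : ℝ) : ℂ) * g (y ^ 2) = ∫ Y in Ioo 0 (x ^ 2), g Y := by
  have himg : (fun y : ℝ => y ^ 2) '' Ioo 0 x = Ioo 0 (x ^ 2) := by
    ext Y
    simp only [mem_image, mem_Ioo]
    constructor
    · rintro ⟨y, ⟨h0, h1⟩, rfl⟩
      exact ⟨by positivity, pow_lt_pow_left₀ h1 h0.le two_ne_zero⟩
    · rintro ⟨h0, h1⟩
      exact ⟨√Y, ⟨Real.sqrt_pos.2 h0, (Real.sqrt_lt' hx).2 h1⟩, Real.sq_sqrt h0.le⟩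
  rw [← himg, integral_image_eq_integral_abs_deriv_smul measurableSet_Ioo
    (f' := fun y => 2 * y) (fun y _ => by simpa using (hasDerivAt_pow 2 y).hasDerivWithinAt)
    (fun a ha b hb hab => (pow_left_inj₀ ha.1.le hb.1.le two_ne_zero).1 hab)]
  refine setIntegral_congr_fun measurableSet_Ioo fun y hy => ?_
  have : 0 < 2 * y := by linarith [hy.1]
  rw [abs_of_pos this, Complex.real_smul]

/-- The factor by which the Bessel fractional integral of order `β` multiplies powers. -/
noncomputable def besselMomentCoeff (ν : ℝ) (β σ : ℂ) : ℂ :=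
  (2 : ℂ) ^ (-(2 * β)) *
    (Complex.Gamma ((σ + 1) / 2) * Complex.Gamma ((σ + 1) / 2 + (1 - (ν : ℂ)) / 2)) /
    (Complex.Gamma ((σ + 1) / 2 + β) * Complex.Gamma ((σ + 1) / 2 + (1 - (ν : ℂ)) / 2 + β))

/-- In the variable `Y = y²` the measure `y^σ dy` is `Y^(τ - 1) dY / 2` with `τ = (σ + 1)/2`, and
the integral becomes `iterated_beta_integral` with `κ = (1 - ν)/2 - β`. -/
theorem besselFracKernel_moment {ν : ℝ} (hν1 : ν < 1) {β σ : ℂ} (hβ : 0 < β.re)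
    (hσ : 0 ≤ σ.re) {x : ℝ} (hx : 0 < x) :
    ∫ y in Ioo 0 x, besselFracKernel ν β y x * (y : ℂ) ^ σ =
      besselMomentCoeff ν β σ * (x : ℂ) ^ (σ + 2 * β) := by
  set τ : ℂ := (σ + 1) / 2 with hτd
  have hτ : 0 < τ.re := by rw [hτd]; simp; linarith
  have hδ : 0 < ((1 - (ν : ℂ)) / 2).re := by
    rw [show (1 - (ν : ℂ)) / 2 = (((1 - ν) / 2 : ℝ) : ℂ) by push_cast; ring, Complex.ofReal_re]
    linarith
  have e0 : τ + β + ((1 - (ν : ℂ)) / 2 - β) = τ + (1 - (ν : ℂ)) / 2 := by ring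
  have hκ : 0 < (τ + β + ((1 - (ν : ℂ)) / 2 - β)).re := by
    rw [e0, Complex.add_re]; linarith
  have hit := iterated_beta_integral hτ hβ hκ (pow_pos hx 2)
  rw [← integral_Ioo_comp_sq hx] at hit
  have hL : ∫ y in Ioo 0 x, besselFracKernel ν β y x * (y : ℂ) ^ σ =
      ((x ^ ν : ℝ) : ℂ) * ((Complex.Gamma β * Complex.Gamma β)⁻¹ * (2 : ℂ) ^ (1 - 2 * β)) * 2⁻¹ *
      ∫ y in Ioo 0 x, ((2 * y : ℝ) : ℂ) * (((y ^ 2 : ℝ) : ℂ) ^ (τ - 1) * ∫ S in Ioo (y ^ 2) (x ^ 2),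
        ((x ^ 2 - S : ℝ) : ℂ) ^ (β - 1) * ((S - y ^ 2 : ℝ) : ℂ) ^ (β - 1) *
        (S : ℂ) ^ ((1 - (ν : ℂ)) / 2 - β)) := by
    rw [← integral_const_mul]
    refine setIntegral_congr_fun measurableSet_Ioo fun y hy => ?_
    have hy0 : (y : ℂ) ≠ 0 := by exact_mod_cast hy.1.ne'
    have hpow : (y : ℂ) ^ σ = y * ((y ^ 2 : ℝ) : ℂ) ^ (τ - 1) := by
      have hexp : (y : ℂ) = Complex.exp (Real.log y) := by
        rw [← Complex.ofReal_exp, Real.exp_log hy.1]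
      rw [ofReal_cpow_eq_exp hy.1, ofReal_cpow_eq_exp (pow_pos hy.1 2), Real.log_pow]
      rw [hexp]
      rw [← Complex.exp_add, hτd]
      congr 1
      push_cast
      ring
    rw [besselFracKernel_eq_symmPart ν hβ hy.1 hx hy.2.ne, besselSymmPart_eq_integral ν β
      (pow_lt_pow_left₀ hy.2 hy.1.le two_ne_zero), hpow]
    push_cast
    ring
  rw [hL, hit, e0, besselMomentCoeff, ← hτd]
  have hGβ := Complex.Gamma_ne_zero_of_re_pos hβ
  have hpow : ((x ^ ν : ℝ) : ℂ) * ((x ^ 2 : ℝ) : ℂ) ^ (τ + (1 - (ν : ℂ)) / 2 + β - 1) =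
      (x : ℂ) ^ (σ + 2 * β) := by
    rw [Complex.ofReal_cpow hx.le, ofReal_cpow_eq_exp hx, ofReal_cpow_eq_exp (pow_pos hx 2),
      ofReal_cpow_eq_exp hx, ← Complex.exp_add, Real.log_pow, hτd]
    congr 1
    push_cast
    ring
  have h2 : (2 : ℂ) ^ (1 - 2 * β) = 2 * 2 ^ (-(2 * β)) := by
    rw [sub_eq_add_neg, Complex.cpow_add _ _ two_ne_zero, Complex.cpow_one]
  rw [← hpow, h2]
  field_simp

/-- The semigroup law read on powers: the Gamma factors in the denominator of the first multiplier
cancel those in the numerator of the second. -/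
theorem besselMomentCoeff_mul {ν : ℝ} (hν1 : ν < 1) {β γ σ : ℂ} (hβ : 0 < β.re)
    (hσ : 0 ≤ σ.re) :
    besselMomentCoeff ν β σ * besselMomentCoeff ν γ (σ + 2 * β) =
      besselMomentCoeff ν (β + γ) σ := by
  have hτ : 0 < ((σ + 1) / 2 + β).re := by simp; linarith
  have hδ : 0 < ((1 - (ν : ℂ)) / 2).re := by
    rw [show (1 - (ν : ℂ)) / 2 = (((1 - ν) / 2 : ℝ) : ℂ) by push_cast; ring, Complex.ofReal_re]
    linarith
  have h1 := Complex.Gamma_ne_zero_of_re_pos hτ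
  have h2 : Complex.Gamma ((σ + 1) / 2 + (1 - (ν : ℂ)) / 2 + β) ≠ 0 :=
    Complex.Gamma_ne_zero_of_re_pos (by
      rw [add_right_comm, Complex.add_re]; linarith)
  unfold besselMomentCoeff
  rw [show (σ + 2 * β + 1) / 2 = (σ + 1) / 2 + β by ring,
    show (σ + 1) / 2 + β + (1 - (ν : ℂ)) / 2 = (σ + 1) / 2 + (1 - (ν : ℂ)) / 2 + β by ring,
    show -(2 * (β + γ)) = -(2 * β) + -(2 * γ) by ring, Complex.cpow_add _ _ two_ne_zero,
    ← add_assoc, ← add_assoc]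
  generalize Complex.Gamma ((σ + 1) / 2 + β) = A at *
  generalize Complex.Gamma ((σ + 1) / 2 + (1 - (ν : ℂ)) / 2 + β) = B at *
  generalize Complex.Gamma ((σ + 1) / 2 + β + γ) = C
  generalize Complex.Gamma ((σ + 1) / 2 + (1 - (ν : ℂ)) / 2 + β + γ) = D
  field_simp

/-! ### Bounded operators on `L¹(0, b)` that vanish on monomials. -/

/-- `T` induces a bounded linear operator on the space of integrable functions on `(0, b)`. -/
structure IsBoundedL1Op (b : ℝ) (T : (ℝ → ℂ) → ℝ → ℂ) : Prop where
  maps : ∀ f, IntegrableOn f (Ioo 0 b) → IntegrableOn (T f) (Ioo 0 b)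
  congr : ∀ f g, f =ᵐ[volume.restrict (Ioo 0 b)] g → T f =ᵐ[volume.restrict (Ioo 0 b)] T g
  add : ∀ f g, IntegrableOn f (Ioo 0 b) → IntegrableOn g (Ioo 0 b) →
    T (f + g) =ᵐ[volume.restrict (Ioo 0 b)] T f + T g
  smul : ∀ (c : ℂ) f, T (c • f) =ᵐ[volume.restrict (Ioo 0 b)] c • T f
  bound : ∃ M : ℝ, 0 ≤ M ∧ ∀ f, IntegrableOn f (Ioo 0 b) →
    ∫ x in Ioo 0 b, ‖T f x‖ ≤ M * ∫ x in Ioo 0 b, ‖f x‖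

namespace IsBoundedL1Op

variable {b : ℝ} {T U : (ℝ → ℂ) → ℝ → ℂ}

theorem comp (hT : IsBoundedL1Op b T) (hU : IsBoundedL1Op b U) :
    IsBoundedL1Op b (fun f => T (U f)) where
  maps f hf := hT.maps _ (hU.maps f hf)
  congr f g h := hT.congr _ _ (hU.congr f g h)
  add f g hf hg := (hT.congr _ _ (hU.add f g hf hg)).trans
    (hT.add _ _ (hU.maps f hf) (hU.maps g hg))
  smul c f := (hT.congr _ _ (hU.smul c f)).trans (hT.smul c _)
  bound := by
    obtain ⟨M, hM, h⟩ := hT.bound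
    obtain ⟨N, hN, h'⟩ := hU.bound
    refine ⟨M * N, by positivity, fun f hf => (h _ (hU.maps f hf)).trans ?_⟩
    rw [mul_assoc]
    exact mul_le_mul_of_nonneg_left (h' f hf) hM

theorem const_smul (c : ℂ) (hT : IsBoundedL1Op b T) : IsBoundedL1Op b (fun f => c • T f) where
  maps f hf := (hT.maps f hf).smul c
  congr f g h := (hT.congr f g h).const_smul c
  add f g hf hg := ((hT.add f g hf hg).const_smul c).trans (by rw [smul_add])
  smul d f := ((hT.smul d f).const_smul c).trans (by rw [smul_comm])
  bound := by
    obtain ⟨M, hM, h⟩ := hT.bound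
    refine ⟨‖c‖ * M, by positivity, fun f hf => ?_⟩
    simp only [Pi.smul_apply, norm_smul]
    rw [integral_const_mul, mul_assoc]
    exact mul_le_mul_of_nonneg_left (h f hf) (norm_nonneg c)

theorem sum (hT : IsBoundedL1Op b T) (hU : IsBoundedL1Op b U) :
    IsBoundedL1Op b (fun f => T f + U f) where
  maps f hf := (hT.maps f hf).add (hU.maps f hf)
  congr f g h := (hT.congr f g h).add (hU.congr f g h)
  add f g hf hg := ((hT.add f g hf hg).add (hU.add f g hf hg)).trans (by rw [add_add_add_comm])
  smul c f := ((hT.smul c f).add (hU.smul c f)).trans (by rw [smul_add])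
  bound := by
    obtain ⟨M, hM, h⟩ := hT.bound
    obtain ⟨N, hN, h'⟩ := hU.bound
    refine ⟨M + N, by positivity, fun f hf => ?_⟩
    rw [add_mul]
    refine le_trans ?_ (add_le_add (h f hf) (h' f hf))
    rw [← integral_add (hT.maps f hf).norm (hU.maps f hf).norm]
    exact integral_mono ((hT.maps f hf).add (hU.maps f hf)).norm
      ((hT.maps f hf).norm.add (hU.maps f hf).norm) fun x => norm_add_le _ _

theorem eq_zero_of_approx (hT : IsBoundedL1Op b T) {f : ℝ → ℂ} (hf : IntegrableOn f (Ioo 0 b))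
    (h : ∀ ε > 0, ∃ g, IntegrableOn g (Ioo 0 b) ∧ T g =ᵐ[volume.restrict (Ioo 0 b)] 0 ∧
      ∫ x in Ioo 0 b, ‖f x - g x‖ ≤ ε) : T f =ᵐ[volume.restrict (Ioo 0 b)] 0 := by
  obtain ⟨M, hM, hb⟩ := hT.bound
  have h0 : ∫ x in Ioo 0 b, ‖T f x‖ ≤ 0 := by
    refine le_of_forall_pos_le_add fun ε hε => ?_
    -- Dividing by `M + 1` rather than `M` covers the case `M = 0`.
    obtain ⟨g, hg, hTg, hd⟩ := h (ε / (M + 1)) (by positivity)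
    have e : T f =ᵐ[volume.restrict (Ioo 0 b)] T (f - g) := by
      have := hT.add (f - g) g (hf.sub hg) hg
      rw [sub_add_cancel] at this
      filter_upwards [this, hTg] with x hx hx'
      rw [hx, Pi.add_apply, hx', Pi.zero_apply, add_zero]
    have e' : ∫ x in Ioo 0 b, ‖T f x‖ = ∫ x in Ioo 0 b, ‖T (f - g) x‖ :=
      integral_congr_ae (e.fun_comp norm)
    rw [zero_add, e']
    refine (hb _ (hf.sub hg)).trans ((mul_le_mul_of_nonneg_left hd hM).trans ?_)
    rw [mul_div_assoc', div_le_iff₀ (by positivity)]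
    nlinarith
  have h1 := (integral_eq_zero_iff_of_nonneg (fun x => norm_nonneg (T f x))
    (hT.maps f hf).norm).1 (le_antisymm h0 (integral_nonneg fun x => norm_nonneg _))
  filter_upwards [h1] with x hx
  simpa using hx

theorem integrableOn_of_continuous {f : ℝ → ℂ} (hf : Continuous f) : IntegrableOn f (Ioo 0 b) :=
  (hf.integrableOn_Icc).mono_set Ioo_subset_Icc_self

theorem eq_zero_of_polynomial (hT : IsBoundedL1Op b T)
    (h : ∀ n : ℕ, T (fun y => (y : ℂ) ^ n) =ᵐ[volume.restrict (Ioo 0 b)] 0)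
    (P : Polynomial ℝ) : T (fun y => ((P.eval y : ℝ) : ℂ)) =ᵐ[volume.restrict (Ioo 0 b)] 0 := by
  induction P using Polynomial.induction_on' with
  | add p q hp hq =>
    have e : (fun y : ℝ => (((p + q).eval y : ℝ) : ℂ)) =
        (fun y => ((p.eval y : ℝ) : ℂ)) + fun y => ((q.eval y : ℝ) : ℂ) := by
      ext y; simp
    rw [e]
    refine (hT.add _ _ (integrableOn_of_continuous (by fun_prop))
      (integrableOn_of_continuous (by fun_prop))).trans ?_
    simpa using hp.add hq
  | monomial n a =>
    have e : (fun y : ℝ => ((((Polynomial.monomial n a).eval y : ℝ)) : ℂ)) =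
        (a : ℂ) • fun y : ℝ => (y : ℂ) ^ n := by
      ext y; simp
    rw [e]
    refine (hT.smul _ _).trans ?_
    simpa using (h n).const_smul (a : ℂ)

/-- Density of polynomials in `L¹(0, b)`: approximate by a bounded continuous function within `ε/2`,
then apply Weierstrass with uniform error `ε/(2b)`, which costs another `ε/2` on an interval of
length `b`. -/
theorem eq_zero_of_real (hb : 0 < b) (hT : IsBoundedL1Op b T)
    (h : ∀ n : ℕ, T (fun y => (y : ℂ) ^ n) =ᵐ[volume.restrict (Ioo 0 b)] 0)
    {u : ℝ → ℝ} (hu : IntegrableOn u (Ioo 0 b)) :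
    T (fun y => (u y : ℂ)) =ᵐ[volume.restrict (Ioo 0 b)] 0 := by
  refine hT.eq_zero_of_approx hu.ofReal fun ε hε => ?_
  obtain ⟨g, hg, hgi⟩ := hu.exists_boundedContinuous_integral_sub_le (half_pos hε)
  obtain ⟨P, hP⟩ := exists_polynomial_near_of_continuousOn 0 b g g.continuous.continuousOn
    (ε / (2 * b)) (by positivity)
  have hPi : IntegrableOn (fun y => P.eval y) (Ioo 0 b) :=
    ((Polynomial.continuous P).integrableOn_Icc).mono_set Ioo_subset_Icc_self
  refine ⟨_, integrableOn_of_continuous (f := fun y : ℝ => ((P.eval y : ℝ) : ℂ)) (by fun_prop),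
    hT.eq_zero_of_polynomial h P, ?_⟩
  calc ∫ x in Ioo 0 b, ‖(u x : ℂ) - ((P.eval x : ℝ) : ℂ)‖
      ≤ ∫ x in Ioo 0 b, (‖u x - g x‖ + ε / (2 * b)) := by
        refine setIntegral_mono_on (hu.ofReal.sub hPi.ofReal).norm
          ((hu.sub hgi).norm.add (integrableOn_const (by simp))) measurableSet_Ioo fun x hx => ?_
        rw [← Complex.ofReal_sub, Complex.norm_real]
        have := (hP x ⟨hx.1.le, hx.2.le⟩).le
        rw [abs_sub_comm] at this
        calc ‖u x - P.eval x‖ = ‖(u x - g x) + (g x - P.eval x)‖ := by ring_nf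
          _ ≤ _ := (norm_add_le _ _).trans (by gcongr; exact this)
    _ = (∫ x in Ioo 0 b, ‖u x - g x‖) + ε / 2 := by
        have := integral_add (hu.sub hgi).norm (integrableOn_const (μ := volume)
          (s := Ioo 0 b) (C := ε / (2 * b)) (by simp))
        simp only [Pi.sub_apply] at this
        rw [this, setIntegral_const]
        simp [hb.le]
        field_simp
    _ ≤ ε := by linarith

theorem eq_zero_of_pow (hb : 0 < b) (hT : IsBoundedL1Op b T)
    (h : ∀ n : ℕ, T (fun y => (y : ℂ) ^ n) =ᵐ[volume.restrict (Ioo 0 b)] 0)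
    {f : ℝ → ℂ} (hf : IntegrableOn f (Ioo 0 b)) :
    T f =ᵐ[volume.restrict (Ioo 0 b)] 0 := by
  have e : f = (fun y => ((f y).re : ℂ)) + Complex.I • fun y => ((f y).im : ℂ) := by
    ext y
    simp only [Pi.add_apply, Pi.smul_apply, smul_eq_mul]
    rw [mul_comm, Complex.re_add_im]
  have hre : IntegrableOn (fun y => (f y).re) (Ioo 0 b) := hf.re
  have him : IntegrableOn (fun y => (f y).im) (Ioo 0 b) := hf.im
  have hre' : IntegrableOn (fun y => ((f y).re : ℂ)) (Ioo 0 b) := hre.ofReal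
  have him' : IntegrableOn (fun y => ((f y).im : ℂ)) (Ioo 0 b) := him.ofReal
  have h1 := hT.eq_zero_of_real hb h hre
  have h2 := hT.eq_zero_of_real hb h him
  rw [e]
  refine (hT.add _ _ hre' (him'.smul Complex.I)).trans ?_
  filter_upwards [h1, h2, hT.smul Complex.I fun y => ((f y).im : ℂ)] with x h1 h2 h3
  rw [Pi.add_apply, h3, Pi.smul_apply, h1, h2]
  simp

end IsBoundedL1Op

/-! ### Volterra operators with weakly singular kernels. -/

/-- A measurable kernel on `0 < y < x` that is locally dominated by a multiple of
`(x - y) ^ (e - 1)`. -/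
structure IsWeaklySingular (e : ℝ) (k : ℝ → ℝ → ℂ) : Prop where
  meas : AEStronglyMeasurable (Function.uncurry k)
    (volume.restrict {p : ℝ × ℝ | 0 < p.2 ∧ p.2 < p.1})
  bound : ∀ b : ℝ, 0 < b → ∃ C : ℝ, 0 ≤ C ∧ ∀ y x, 0 < y → y < x → x < b →
    ‖k x y‖ ≤ C * (x - y) ^ (e - 1)

/-- The Volterra integral operator on the half-line with the kernel `k`. -/
noncomputable def volterra (k : ℝ → ℝ → ℂ) (f : ℝ → ℂ) (x : ℝ) : ℂ :=
  ∫ y in Ioo 0 x, k x y * f y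

namespace IsWeaklySingular

variable {e b : ℝ} {k : ℝ → ℝ → ℂ}

theorem kernel_integrableOn (he : 0 < e) {y b : ℝ} :
    IntegrableOn (fun x => (x - y) ^ (e - 1)) (Ioo y b) := by
  rcases le_or_gt b y with h | h
  · simp [Ioo_eq_empty_of_le h]
  · have := (intervalIntegral.intervalIntegrable_rpow' (a := 0) (b := b - y)
      (by linarith : -1 < e - 1)).comp_sub_right y
    rw [zero_add, sub_add_cancel] at this
    exact (intervalIntegrable_iff_integrableOn_Ioo_of_le h.le).1 this

theorem kernel_integral_le (he : 0 < e) {y b : ℝ} (hy : 0 < y) (hyb : y < b) :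
    ∫ x in Ioo y b, (x - y) ^ (e - 1) ≤ b ^ e / e := by
  have h := intervalIntegral.integral_comp_sub_right (a := y) (b := b)
    (fun x : ℝ => x ^ (e - 1)) y
  rw [intervalIntegral.integral_of_le hyb.le, integral_Ioc_eq_integral_Ioo, sub_self,
    integral_rpow (Or.inl (by linarith)), sub_add_cancel, Real.zero_rpow he.ne', sub_zero] at h
  rw [h]
  exact div_le_div_of_nonneg_right
    (Real.rpow_le_rpow (by linarith) (by linarith) he.le) he.le

/-- The integrand of the Volterra operator, extended by zero to the square. -/
noncomputable def squareIntegrand (k : ℝ → ℝ → ℂ) (f : ℝ → ℂ) (p : ℝ × ℝ) : ℂ :=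
  {p : ℝ × ℝ | p.2 < p.1}.indicator (fun p => k p.1 p.2 * f p.2) p

theorem squareIntegrand_meas (hk : IsWeaklySingular e k) {f : ℝ → ℂ}
    (hf : IntegrableOn f (Ioo 0 b)) : AEStronglyMeasurable (squareIntegrand k f)
      ((volume.restrict (Ioo 0 b)).prod (volume.restrict (Ioo 0 b))) := by
  have hs : MeasurableSet {p : ℝ × ℝ | p.2 < p.1} := measurableSet_lt measurable_snd measurable_fst
  have : squareIntegrand k f = {p : ℝ × ℝ | p.2 < p.1}.indicator fun p => k p.1 p.2 * f p.2 := rfl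
  rw [this, aestronglyMeasurable_indicator_iff hs]
  refine AEStronglyMeasurable.mul ?_ hf.aestronglyMeasurable.comp_snd.restrict
  rw [Measure.prod_restrict, Measure.restrict_restrict hs]
  refine hk.meas.mono_measure (Measure.restrict_mono ?_ le_rfl)
  rintro ⟨x, y⟩ ⟨h1, h2⟩
  exact ⟨h2.2.1, h1⟩

theorem squareIntegrand_right (f : ℝ → ℂ) (y : ℝ) :
    (fun x => squareIntegrand k f (x, y)) = (Ioi y).indicator fun x => k x y * f y := by
  ext x; simp only [squareIntegrand, indicator, mem_Ioi, mem_ofPred_eq]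

theorem squareIntegrand_left (f : ℝ → ℂ) (x : ℝ) :
    (fun y => squareIntegrand k f (x, y)) = (Iio x).indicator fun y => k x y * f y := by
  ext y; simp only [squareIntegrand, indicator, mem_Iio, mem_ofPred_eq]

theorem Ioi_inter_Ioo {y : ℝ} (hy : 0 < y) : Ioi y ∩ Ioo 0 b = Ioo y b := by
  ext x; simp only [mem_inter_iff, mem_Ioi, mem_Ioo]
  constructor
  · rintro ⟨h, -, h'⟩; exact ⟨h, h'⟩
  · rintro ⟨h, h'⟩; exact ⟨h, hy.trans h, h'⟩

theorem Iio_inter_Ioo {x : ℝ} (hx : x < b) : Iio x ∩ Ioo 0 b = Ioo 0 x := by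
  ext y; simp only [mem_inter_iff, mem_Iio, mem_Ioo]
  constructor
  · rintro ⟨h, h', -⟩; exact ⟨h', h⟩
  · rintro ⟨h, h'⟩; exact ⟨h', h, h'.trans hx⟩

/-- The `L¹` Schur test: `∫ |k(x, y)| dx` over `y < x < b` is at most `C b^e / e` uniformly in `y`.
Integrability on the square then gives, through Fubini, both the operator bound and convergence for
almost every `x`. -/
theorem exists_bound (he : 0 < e) (hb : 0 < b) (hk : IsWeaklySingular e k) :
    ∃ M : ℝ, 0 ≤ M ∧ ∀ f : ℝ → ℂ, IntegrableOn f (Ioo 0 b) →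
      Integrable (squareIntegrand k f)
        ((volume.restrict (Ioo 0 b)).prod (volume.restrict (Ioo 0 b))) ∧
      ∀ᵐ y ∂(volume.restrict (Ioo 0 b)),
        ∫ x in Ioo 0 b, ‖squareIntegrand k f (x, y)‖ ≤ M * ‖f y‖ := by
  obtain ⟨C, hC, hbd⟩ := hk.bound b hb
  refine ⟨C * (b ^ e / e), by positivity, fun f hf => ?_⟩
  have hm := hk.squareIntegrand_meas hf
  have hdom : ∀ y ∈ Ioo 0 b, ∀ x ∈ Ioo 0 b, ‖squareIntegrand k f (x, y)‖ ≤
      (Ioi y).indicator (fun x => C * ‖f y‖ * (x - y) ^ (e - 1)) x := by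
    intro y hy x hx
    rw [show squareIntegrand k f (x, y) = (fun x => squareIntegrand k f (x, y)) x from rfl,
      squareIntegrand_right, norm_indicator_eq_indicator_norm]
    by_cases h : x ∈ Ioi y
    swap
    · simp [indicator_of_notMem h]
    rw [indicator_of_mem h, indicator_of_mem h, norm_mul]
    calc ‖k x y‖ * ‖f y‖ ≤ C * (x - y) ^ (e - 1) * ‖f y‖ :=
          mul_le_mul_of_nonneg_right (hbd y x hy.1 h hx.2) (norm_nonneg _)
      _ = _ := by ring
  have hdi : ∀ y ∈ Ioo 0 b, IntegrableOn
      ((Ioi y).indicator fun x => C * ‖f y‖ * (x - y) ^ (e - 1)) (Ioo 0 b) := by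
    intro y hy
    rw [IntegrableOn, integrable_indicator_iff measurableSet_Ioi, IntegrableOn,
      Measure.restrict_restrict measurableSet_Ioi, Ioi_inter_Ioo hy.1]
    exact (kernel_integrableOn he).const_mul _
  have hslice : ∀ᵐ y ∂(volume.restrict (Ioo 0 b)),
      IntegrableOn (fun x => squareIntegrand k f (x, y)) (Ioo 0 b) := by
    filter_upwards [hm.prod_swap.prodMk_left, ae_restrict_mem measurableSet_Ioo] with y hy hyb
    exact Integrable.mono' (hdi y hyb) hy ((ae_restrict_iff' measurableSet_Ioo).2
      (Eventually.of_forall fun x hx => hdom y hyb x hx))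
  have hbound : ∀ᵐ y ∂(volume.restrict (Ioo 0 b)),
      ∫ x in Ioo 0 b, ‖squareIntegrand k f (x, y)‖ ≤ C * (b ^ e / e) * ‖f y‖ := by
    filter_upwards [hslice, ae_restrict_mem measurableSet_Ioo] with y hy hyb
    refine (setIntegral_mono_on hy.norm (hdi y hyb) measurableSet_Ioo
      fun x hx => hdom y hyb x hx).trans ?_
    rw [integral_indicator measurableSet_Ioi, Measure.restrict_restrict measurableSet_Ioi,
      Ioi_inter_Ioo hyb.1, integral_const_mul]
    calc C * ‖f y‖ * ∫ x in Ioo y b, (x - y) ^ (e - 1) ≤ C * ‖f y‖ * (b ^ e / e) :=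
          mul_le_mul_of_nonneg_left (kernel_integral_le he hyb.1 hyb.2) (by positivity)
      _ = _ := by ring
  refine ⟨(integrable_prod_iff' hm).2 ⟨hslice, ?_⟩, hbound⟩
  refine Integrable.mono' (hf.norm.const_mul (C * (b ^ e / e)))
    hm.norm.prod_swap.integral_prod_right' ?_
  filter_upwards [hbound] with y hy
  rwa [Real.norm_of_nonneg (integral_nonneg fun _ => norm_nonneg _)]

theorem volterra_eq_integral {x : ℝ} (f : ℝ → ℂ) (hx : x < b) :
    volterra k f x = ∫ y in Ioo 0 b, squareIntegrand k f (x, y) := by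
  rw [squareIntegrand_left, integral_indicator measurableSet_Iio,
    Measure.restrict_restrict measurableSet_Iio, Iio_inter_Ioo hx, volterra]

theorem ae_integrableOn (he : 0 < e) (hb : 0 < b) (hk : IsWeaklySingular e k) {f : ℝ → ℂ}
    (hf : IntegrableOn f (Ioo 0 b)) : ∀ᵐ x ∂(volume.restrict (Ioo 0 b)),
      IntegrableOn (fun y => k x y * f y) (Ioo 0 x) := by
  obtain ⟨M, -, h⟩ := hk.exists_bound he hb
  filter_upwards [(h f hf).1.prod_right_ae, ae_restrict_mem measurableSet_Ioo] with x hx hxb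
  rwa [squareIntegrand_left, integrable_indicator_iff measurableSet_Iio, IntegrableOn,
    Measure.restrict_restrict measurableSet_Iio, Iio_inter_Ioo hxb.2] at hx

theorem isBoundedL1Op (he : 0 < e) (hb : 0 < b) (hk : IsWeaklySingular e k) :
    IsBoundedL1Op b (volterra k) where
  maps f hf := by
    obtain ⟨M, -, h⟩ := hk.exists_bound he hb
    exact IntegrableOn.congr_fun (h f hf).1.integral_prod_left
      (fun x hx => (volterra_eq_integral f hx.2).symm) measurableSet_Ioo
  congr f g h := by
    refine (ae_restrict_iff' measurableSet_Ioo).2 (Eventually.of_forall fun x hx => ?_)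
    refine integral_congr_ae ?_
    filter_upwards [ae_mono (Measure.restrict_mono (Ioo_subset_Ioo_right hx.2.le) le_rfl) h]
      with y hy
    rw [hy]
  add f g hf hg := by
    filter_upwards [hk.ae_integrableOn he hb hf, hk.ae_integrableOn he hb hg] with x h1 h2
    simp only [volterra, Pi.add_apply, mul_add]
    exact integral_add h1 h2
  smul c f := by
    refine Eventually.of_forall fun x => ?_
    simp only [volterra, Pi.smul_apply, smul_eq_mul]
    rw [← integral_const_mul]
    congr 1
    ext y
    ring
  bound := by
    obtain ⟨M, hM, h⟩ := hk.exists_bound he hb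
    refine ⟨M, hM, fun f hf => ?_⟩
    obtain ⟨hi, hb⟩ := h f hf
    calc ∫ x in Ioo 0 b, ‖volterra k f x‖
        = ∫ x in Ioo 0 b, ‖∫ y in Ioo 0 b, squareIntegrand k f (x, y)‖ :=
          setIntegral_congr_fun measurableSet_Ioo fun x hx => by
            rw [volterra_eq_integral f hx.2]
      _ ≤ ∫ x in Ioo 0 b, ∫ y in Ioo 0 b, ‖squareIntegrand k f (x, y)‖ :=
          integral_mono hi.integral_prod_left.norm hi.norm.integral_prod_left
            fun x => norm_integral_le_integral_norm _
      _ = ∫ y in Ioo 0 b, ∫ x in Ioo 0 b, ‖squareIntegrand k f (x, y)‖ :=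
          integral_integral_swap hi.norm
      _ ≤ ∫ y in Ioo 0 b, M * ‖f y‖ :=
          integral_mono_ae hi.norm.integral_prod_right (hf.norm.const_mul M) hb
      _ = M * ∫ x in Ioo 0 b, ‖f x‖ := integral_const_mul _ _

end IsWeaklySingular

/-! ### Continuity and weak singularity of the two kernels. -/

theorem isOpen_triangle : IsOpen {p : ℝ × ℝ | 0 < p.2 ∧ p.2 < p.1} :=
  (isOpen_lt continuous_const continuous_snd).inter (isOpen_lt continuous_snd continuous_fst)

/-- For `y < x` the argument `1 - y²/x²` lies in `(0, 1)`, so only the power-series branch of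
`gaussHyp` occurs. -/
theorem besselFracKernel_continuousOn {ν : ℝ} (hν1 : ν < 1) {β : ℂ} (hβ : (1 - ν) / 2 < β.re) :
    ContinuousOn (fun p : ℝ × ℝ => besselFracKernel ν β p.2 p.1)
      {p : ℝ × ℝ | 0 < p.2 ∧ p.2 < p.1} := by
  have hβ0 := re_pos_of_lt hν1 hβ
  have hz : ∀ p ∈ {p : ℝ × ℝ | 0 < p.2 ∧ p.2 < p.1}, |1 - p.2 ^ 2 / p.1 ^ 2| < 1 := by
    rintro ⟨x, y⟩ ⟨hy, hyx⟩
    simp only at hy hyx ⊢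
    have hx := hy.trans hyx
    have h1 : y ^ 2 / x ^ 2 < 1 := by
      rw [div_lt_one (by positivity)]; exact pow_lt_pow_left₀ hyx hy.le two_ne_zero
    have h0 : 0 < y ^ 2 / x ^ 2 := by positivity
    rw [abs_lt]; constructor <;> linarith
  have hne : ∀ p ∈ {p : ℝ × ℝ | 0 < p.2 ∧ p.2 < p.1}, p.1 ≠ 0 :=
    fun p hp => (hp.1.trans hp.2).ne'
  have hzc : ContinuousOn (fun p : ℝ × ℝ => 1 - p.2 ^ 2 / p.1 ^ 2)
      {p : ℝ × ℝ | 0 < p.2 ∧ p.2 < p.1} :=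
    continuousOn_const.sub ((continuous_snd.pow 2).continuousOn.div
      (continuous_fst.pow 2).continuousOn fun p hp => pow_ne_zero 2 (hne p hp))
  have hmc : ContinuousOn (fun p : ℝ × ℝ => |p.2 ^ 2 - p.1 ^ 2| / (2 * p.1))
      {p : ℝ × ℝ | 0 < p.2 ∧ p.2 < p.1} :=
    ContinuousOn.div (by fun_prop) (by fun_prop)
      fun p hp => mul_ne_zero two_ne_zero (hne p hp)
  have h : ContinuousOn (fun p : ℝ × ℝ => (Complex.Gamma (2 * β))⁻¹ *
      ((|p.2 ^ 2 - p.1 ^ 2| / (2 * p.1) : ℝ) : ℂ) ^ (2 * β - 1) *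
      ordinaryHypergeometric (β + ((ν : ℂ) - 1) / 2) β (2 * β)
        ((1 - p.2 ^ 2 / p.1 ^ 2 : ℝ) : ℂ)) {p : ℝ × ℝ | 0 < p.2 ∧ p.2 < p.1} := by
    refine (continuousOn_const.mul ?_).mul ?_
    · refine (Complex.continuous_ofReal.comp_continuousOn hmc).cpow continuousOn_const ?_
      rintro ⟨x, y⟩ ⟨hy, hyx⟩
      simp only at hy hyx
      have hx := hy.trans hyx
      refine Complex.ofReal_mem_slitPlane.2 ?_
      have : 0 < |y ^ 2 - x ^ 2| := by
        rw [abs_pos, sub_ne_zero, Ne, sq_eq_sq₀ hy.le hx.le]; exact hyx.ne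
      simp only
      positivity
    · refine (ordinaryHypergeometric_continuousOn_ball (re_add_pos_of_lt hβ) hβ0
        (by simpa using hβ0)).comp (Complex.continuous_ofReal.comp_continuousOn hzc) ?_
      intro p hp
      rw [mem_ball_zero_iff]
      beta_reduce
      rw [Complex.norm_real]
      exact hz p hp
  refine h.congr fun p hp => ?_
  unfold besselFracKernel gaussHyp
  rw [if_pos (hz p hp)]

section

variable {ν : ℝ} {α lam : ℂ}

theorem neumannTerm_continuousOn (hν1 : ν < 1) (hα : (1 - ν) / 2 < α.re) (k : ℕ) :
    ContinuousOn (fun p : ℝ × ℝ => neumannTerm ν α lam k p.2 p.1)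
      {p : ℝ × ℝ | 0 < p.2 ∧ p.2 < p.1} :=
  continuousOn_const.mul (besselFracKernel_continuousOn hν1 (lt_re_mul_succ hν1 hα k))

theorem neumannTerm_isWeaklySingular (hν1 : ν < 1) (hα : (1 - ν) / 2 < α.re) (k : ℕ) :
    IsWeaklySingular (2 * α.re) fun x y => neumannTerm ν α lam k y x where
  meas := (neumannTerm_continuousOn hν1 hα k).aestronglyMeasurable isOpen_triangle.measurableSet
  bound b hb := by
    obtain ⟨d, -, hd0, hd⟩ := neumannTerm_bound (lam := lam) hν1 hα hb
    exact ⟨d k, hd0 k, fun y x => hd k y x⟩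

theorem besselFracKernel_eq_neumannTerm (hlam : lam ≠ 0) (p q : ℝ) :
    besselFracKernel ν α p q = lam * neumannTerm ν α lam 0 p q := by
  simp [neumannTerm, hlam]

theorem besselFracKernel_isWeaklySingular (hν1 : ν < 1) (hα : (1 - ν) / 2 < α.re) :
    IsWeaklySingular (2 * α.re) fun x y => besselFracKernel ν α y x := by
  have := neumannTerm_isWeaklySingular (lam := 1) hν1 hα 0
  simpa [neumannTerm] using this

theorem besselResolventKernel_isWeaklySingular (hν1 : ν < 1) (hα : (1 - ν) / 2 < α.re) :
    IsWeaklySingular (2 * α.re) fun x y => besselResolventKernel ν α lam y x where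
  meas := by
    refine aestronglyMeasurable_of_hasSum
      (fun k => (neumannTerm_isWeaklySingular (lam := lam) hν1 hα k).meas)
      ((ae_restrict_iff' isOpen_triangle.measurableSet).2 (Eventually.of_forall fun p hp => ?_))
    exact besselResolventKernel_hasSum hν1 hα hp.1 hp.2
  bound b hb := by
    obtain ⟨d, hds, hd0, hd⟩ := neumannTerm_bound (lam := lam) hν1 hα hb
    refine ⟨∑' k, d k, tsum_nonneg hd0, fun y x hy hyx hxb => ?_⟩
    rw [← (besselResolventKernel_hasSum hν1 hα hy hyx).tsum_eq, ← tsum_mul_right]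
    exact tsum_of_norm_bounded (hds.mul_right _).hasSum fun k => hd k y x hy hyx hxb

/-! ### Resolvent identities, on powers and on integrable functions. -/

/-- The `k`-th term of the Neumann series, applied to a power. -/
noncomputable def neumannMoment (ν : ℝ) (α lam : ℂ) (k : ℕ) (σ : ℂ) (x : ℝ) : ℂ :=
  (lam ^ (k + 1))⁻¹ * besselMomentCoeff ν (α * (k + 1 : ℕ)) σ *
    (x : ℂ) ^ (σ + 2 * (α * (k + 1 : ℕ)))

theorem neumannTerm_moment (hν1 : ν < 1) (hα : (1 - ν) / 2 < α.re) (k : ℕ) {σ : ℂ}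
    (hσ : 0 ≤ σ.re) {x : ℝ} (hx : 0 < x) :
    ∫ y in Ioo 0 x, neumannTerm ν α lam k y x * (y : ℂ) ^ σ = neumannMoment ν α lam k σ x := by
  have hβ := re_pos_of_lt hν1 (lt_re_mul_succ hν1 hα k)
  simp only [neumannTerm, neumannMoment, mul_assoc]
  rw [integral_const_mul, besselFracKernel_moment hν1 hβ hσ hx]

/-- Summable bounds uniform in `x < b`: they justify the interchange of sum and integral for `K`,
and a second time when the resulting sum is integrated against `G`. -/
theorem neumannTerm_mul_pow_bound (hν1 : ν < 1) (hα : (1 - ν) / 2 < α.re) {σ : ℂ}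
    (hσ : 0 ≤ σ.re) {b : ℝ} (hb : 0 < b) : ∃ d : ℕ → ℝ, Summable d ∧ ∀ k x, 0 < x → x < b →
      IntegrableOn (fun y => neumannTerm ν α lam k y x * (y : ℂ) ^ σ) (Ioo 0 x) ∧
      ∫ y in Ioo 0 x, ‖neumannTerm ν α lam k y x * (y : ℂ) ^ σ‖ ≤ d k := by
  have h0 := re_pos_of_lt hν1 hα
  have hσ1 : 0 < (σ + 1).re := by simp; linarith
  have h2α : 0 < ((2 * α.re : ℝ) : ℂ).re := by rw [Complex.ofReal_re]; positivity
  obtain ⟨d, hds, hd0, hd⟩ := neumannTerm_bound (lam := lam) hν1 hα hb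
  obtain ⟨C, hC⟩ := scaled_beta_integral_norm hσ1 h2α
  have hre : (σ + 1 + ((2 * α.re : ℝ) : ℂ) - 1).re = σ.re + 2 * α.re := by
    simp only [Complex.sub_re, Complex.add_re, Complex.ofReal_re, Complex.one_re]
    ring
  refine ⟨fun k => d k * (|C| * b ^ (σ.re + 2 * α.re)), hds.mul_right _, fun k x hx hxb => ?_⟩
  have hpt : ∀ y ∈ Ioo 0 x, ‖neumannTerm ν α lam k y x * (y : ℂ) ^ σ‖ ≤
      d k * ‖(y : ℂ) ^ (σ + 1 - 1) * ((x - y : ℝ) : ℂ) ^ (((2 * α.re : ℝ) : ℂ) - 1)‖ := by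
    intro y hy
    have h1 : 0 < x - y := sub_pos.2 hy.2
    rw [norm_mul, norm_mul, add_sub_cancel_right,
      Complex.norm_cpow_eq_rpow_re_of_pos h1, Complex.sub_re, Complex.ofReal_re, Complex.one_re]
    calc _ ≤ d k * (x - y) ^ (2 * α.re - 1) * ‖(y : ℂ) ^ σ‖ :=
          mul_le_mul_of_nonneg_right (hd k y x hy.1 hy.2 hxb) (norm_nonneg _)
      _ = _ := by ring
  have hbi := (scaled_beta_integrableOn hσ1 h2α hx).norm.const_mul (d k)
  have hint : IntegrableOn (fun y => neumannTerm ν α lam k y x * (y : ℂ) ^ σ) (Ioo 0 x) := by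
    refine Integrable.mono' hbi ?_ ((ae_restrict_iff' measurableSet_Ioo).2
      (Eventually.of_forall hpt))
    refine AEStronglyMeasurable.mul ?_ (Measurable.aestronglyMeasurable (by fun_prop))
    refine ContinuousOn.aestronglyMeasurable ?_ measurableSet_Ioo
    exact (neumannTerm_continuousOn (lam := lam) hν1 hα k).comp
      (f := fun y => (x, y)) (by fun_prop) fun y hy => hy
  refine ⟨hint, (setIntegral_mono_on hint.norm hbi measurableSet_Ioo hpt).trans ?_⟩
  rw [integral_const_mul, hC x hx, Complex.norm_cpow_eq_rpow_re_of_pos hx, hre]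
  refine mul_le_mul_of_nonneg_left ?_ (hd0 k)
  exact mul_le_mul (le_abs_self C) (Real.rpow_le_rpow hx.le hxb.le (by positivity))
    (Real.rpow_nonneg hx.le _) (abs_nonneg C)

theorem besselResolventKernel_moment (hν1 : ν < 1) (hα : (1 - ν) / 2 < α.re) {σ : ℂ}
    (hσ : 0 ≤ σ.re) {x : ℝ} (hx : 0 < x) :
    HasSum (fun k => neumannMoment ν α lam k σ x)
      (volterra (fun x y => besselResolventKernel ν α lam y x) (fun y => (y : ℂ) ^ σ) x) := by
  -- The bounds are taken on `(0, x + 1)`; any endpoint beyond `x` would do.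
  obtain ⟨d, hds, hd⟩ := neumannTerm_mul_pow_bound (lam := lam) hν1 hα hσ (add_pos hx one_pos)
  have hd' := fun k => hd k x hx (lt_add_one x)
  have h := hasSum_integral_of_summable_integral_norm (fun k => (hd' k).1)
    (Summable.of_nonneg_of_le (fun k => integral_nonneg fun y => norm_nonneg _)
      (fun k => (hd' k).2) hds)
  simp_rw [neumannTerm_moment hν1 hα _ hσ hx] at h
  convert! h using 1
  refine setIntegral_congr_fun measurableSet_Ioo fun y hy => ?_
  exact ((besselResolventKernel_hasSum hν1 hα hy.1 hy.2).mul_right _).tsum_eq.symm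

theorem neumannMoment_zero (hν1 : ν < 1) (hα : (1 - ν) / 2 < α.re) (hlam : lam ≠ 0) {σ : ℂ}
    (hσ : 0 ≤ σ.re) {x : ℝ} (hx : 0 < x) :
    volterra (fun x y => besselFracKernel ν α y x) (fun y => (y : ℂ) ^ σ) x =
      lam * neumannMoment ν α lam 0 σ x := by
  rw [← neumannTerm_moment hν1 hα 0 hσ hx, ← integral_const_mul]
  simp only [volterra, besselFracKernel_eq_neumannTerm hlam, mul_assoc]

theorem besselMomentCoeff_succ (hν1 : ν < 1) (hα : (1 - ν) / 2 < α.re) (k : ℕ) {σ : ℂ}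
    (hσ : 0 ≤ σ.re) : besselMomentCoeff ν (α * (k + 1 : ℕ)) σ *
      besselMomentCoeff ν α (σ + 2 * (α * (k + 1 : ℕ))) =
      besselMomentCoeff ν (α * (k + 1 + 1 : ℕ)) σ := by
  rw [besselMomentCoeff_mul hν1 (re_pos_of_lt hν1 (lt_re_mul_succ hν1 hα k)) hσ]
  congr 1
  push_cast
  ring

theorem besselMomentCoeff_succ' (hν1 : ν < 1) (hα : (1 - ν) / 2 < α.re) (k : ℕ) {σ : ℂ}
    (hσ : 0 ≤ σ.re) : besselMomentCoeff ν α σ *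
      besselMomentCoeff ν (α * (k + 1 : ℕ)) (σ + 2 * α) =
      besselMomentCoeff ν (α * (k + 1 + 1 : ℕ)) σ := by
  rw [besselMomentCoeff_mul hν1 (re_pos_of_lt hν1 hα) hσ]
  congr 1
  push_cast
  ring

/-- Dropping the first Neumann term and multiplying by `lam` gives `lam K - G`. Both products of `G`
and `K` are compared with this series. -/
theorem neumannMoment_tail (hν1 : ν < 1) (hα : (1 - ν) / 2 < α.re) (hlam : lam ≠ 0) {σ : ℂ}
    (hσ : 0 ≤ σ.re) {x : ℝ} (hx : 0 < x) :
    HasSum (fun k => lam * neumannMoment ν α lam (k + 1) σ x)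
      (lam * volterra (fun x y => besselResolventKernel ν α lam y x) (fun y => (y : ℂ) ^ σ) x -
        volterra (fun x y => besselFracKernel ν α y x) (fun y => (y : ℂ) ^ σ) x) := by
  have h := (hasSum_nat_add_iff' 1).2 (besselResolventKernel_moment (lam := lam) hν1 hα hσ hx)
  have h2 := h.mul_left lam
  rwa [Finset.sum_range_one, mul_sub, ← neumannMoment_zero hν1 hα hlam hσ hx] at h2

/-- `G` maps `y^σ` to a multiple of `y^(σ + 2α)`, and `K` of that power is a known series; the
cocycle law shifts its index by one. -/
theorem volterra_resolvent_frac_pow (hν1 : ν < 1) (hα : (1 - ν) / 2 < α.re) (hlam : lam ≠ 0)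
    {σ : ℂ} (hσ : 0 ≤ σ.re) {x : ℝ} (hx : 0 < x) :
    volterra (fun x y => besselResolventKernel ν α lam y x)
      (volterra (fun x y => besselFracKernel ν α y x) fun y => (y : ℂ) ^ σ) x =
      lam * volterra (fun x y => besselResolventKernel ν α lam y x) (fun y => (y : ℂ) ^ σ) x -
        volterra (fun x y => besselFracKernel ν α y x) (fun y => (y : ℂ) ^ σ) x := by
  have h0 := re_pos_of_lt hν1 hα
  have hσ' : 0 ≤ (σ + 2 * α).re := by simp; linarith
  refine HasSum.unique ?_ (neumannMoment_tail hν1 hα hlam hσ hx)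
  have h := (besselResolventKernel_moment (lam := lam) hν1 hα hσ' hx).mul_left
    (besselMomentCoeff ν α σ)
  convert! h using 2 with k
  · rw [neumannMoment, neumannMoment, ← besselMomentCoeff_succ' hν1 hα k hσ,
      pow_succ lam (k + 1), mul_inv,
      show σ + 2 * (α * (k + 1 + 1 : ℕ)) = σ + 2 * α + 2 * (α * (k + 1 : ℕ)) by push_cast; ring]
    field_simp
  · rw [volterra, volterra, ← integral_const_mul]
    refine setIntegral_congr_fun measurableSet_Ioo fun y hy => ?_
    simp only [volterra]
    rw [besselFracKernel_moment hν1 h0 hσ hy.1]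
    ring

/-- Here `G` is applied to the whole series for `K y^σ`, so it must be integrated term by term
before the cocycle law shifts the index. -/
theorem volterra_frac_resolvent_pow (hν1 : ν < 1) (hα : (1 - ν) / 2 < α.re) (hlam : lam ≠ 0)
    {σ : ℂ} (hσ : 0 ≤ σ.re) {x : ℝ} (hx : 0 < x) :
    volterra (fun x y => besselFracKernel ν α y x)
      (volterra (fun x y => besselResolventKernel ν α lam y x) fun y => (y : ℂ) ^ σ) x =
      lam * volterra (fun x y => besselResolventKernel ν α lam y x) (fun y => (y : ℂ) ^ σ) x -
        volterra (fun x y => besselFracKernel ν α y x) (fun y => (y : ℂ) ^ σ) x := by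
  have h0 := re_pos_of_lt hν1 hα
  refine HasSum.unique ?_ (neumannMoment_tail hν1 hα hlam hσ hx)
  obtain ⟨d, hds, hd⟩ := neumannTerm_mul_pow_bound (lam := lam) hν1 hα hσ (add_pos hx one_pos)
  -- With `lam = 1`, `σ = 0` and index `0` the Neumann term is `G` itself.
  obtain ⟨_, _, hg⟩ := neumannTerm_mul_pow_bound (ν := ν) (α := α) (lam := 1) (σ := 0) hν1 hα
    le_rfl (add_pos hx one_pos)
  have hG : IntegrableOn (fun s => besselFracKernel ν α s x) (Ioo 0 x) := by
    simpa [neumannTerm] using (hg 0 x hx (lt_add_one x)).1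
  have hMb : ∀ k, ∀ s ∈ Ioo 0 x, ‖neumannMoment ν α lam k σ s‖ ≤ d k := by
    intro k s hs
    rw [← neumannTerm_moment hν1 hα k hσ hs.1]
    exact (norm_integral_le_integral_norm _).trans (hd k s hs.1 (hs.2.trans (lt_add_one x))).2
  have hFb : ∀ k, ∀ s ∈ Ioo 0 x, ‖besselFracKernel ν α s x * neumannMoment ν α lam k σ s‖ ≤
      ‖besselFracKernel ν α s x‖ * d k := fun k s hs => by
    rw [norm_mul]
    exact mul_le_mul_of_nonneg_left (hMb k s hs) (norm_nonneg _)
  have hFi : ∀ k, IntegrableOn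
      (fun s => besselFracKernel ν α s x * neumannMoment ν α lam k σ s) (Ioo 0 x) := by
    intro k
    refine Integrable.mono' (hG.norm.mul_const (d k)) ?_ ((ae_restrict_iff' measurableSet_Ioo).2
      (Eventually.of_forall (hFb k)))
    refine hG.aestronglyMeasurable.mul (Measurable.aestronglyMeasurable ?_)
    unfold neumannMoment
    fun_prop
  have h := hasSum_integral_of_summable_integral_norm hFi
    (Summable.of_nonneg_of_le (fun k => integral_nonneg fun s => norm_nonneg _)
      (fun k => setIntegral_mono_on (hFi k).norm (hG.norm.mul_const (d k)) measurableSet_Ioo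
        (hFb k)) (by simp_rw [integral_mul_const]; exact hds.mul_left _))
  convert! h using 2 with k
  · have hσ' : 0 ≤ (σ + 2 * (α * (k + 1 : ℕ))).re := by
      have := re_pos_of_lt hν1 (lt_re_mul_succ hν1 hα k)
      rw [Complex.add_re, show (2 : ℂ) = ((2 : ℝ) : ℂ) by norm_num, Complex.re_ofReal_mul]
      linarith
    have hm := besselFracKernel_moment (σ := σ + 2 * (α * (k + 1 : ℕ))) hν1 h0 hσ' hx
    have e : ∀ s, besselFracKernel ν α s x * neumannMoment ν α lam k σ s =
        (lam ^ (k + 1))⁻¹ * besselMomentCoeff ν (α * (k + 1 : ℕ)) σ *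
          (besselFracKernel ν α s x * (s : ℂ) ^ (σ + 2 * (α * (k + 1 : ℕ)))) := by
      intro s; rw [neumannMoment]; ring
    simp_rw [e]
    rw [integral_const_mul, hm, neumannMoment, ← besselMomentCoeff_succ hν1 hα k hσ,
      pow_succ lam (k + 1), mul_inv,
      show σ + 2 * (α * (k + 1 + 1 : ℕ)) = σ + 2 * (α * (k + 1 : ℕ)) + 2 * α by push_cast; ring]
    field_simp
  · refine setIntegral_congr_fun measurableSet_Ioo fun s hs => ?_
    simp only
    rw [tsum_mul_left, (besselResolventKernel_moment hν1 hα hσ hs.1).tsum_eq]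

/-- `GK - lam K + G` and `KG - lam K + G` are bounded on `L¹(0, b)` and vanish on every `y^n`. -/
theorem resolvent_identities (hν1 : ν < 1) (hα : (1 - ν) / 2 < α.re) (hlam : lam ≠ 0) {b : ℝ}
    (hb : 0 < b) {f : ℝ → ℂ} (hf : IntegrableOn f (Ioo 0 b)) :
    (∀ᵐ x ∂(volume.restrict (Ioo 0 b)), volterra (fun x y => besselFracKernel ν α y x)
      (volterra (fun x y => besselResolventKernel ν α lam y x) f) x =
        lam * volterra (fun x y => besselResolventKernel ν α lam y x) f x -
        volterra (fun x y => besselFracKernel ν α y x) f x) ∧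
    (∀ᵐ x ∂(volume.restrict (Ioo 0 b)), volterra (fun x y => besselResolventKernel ν α lam y x)
      (volterra (fun x y => besselFracKernel ν α y x) f) x =
        lam * volterra (fun x y => besselResolventKernel ν α lam y x) f x -
        volterra (fun x y => besselFracKernel ν α y x) f x) := by
  have h2 : 0 < 2 * α.re := by have := re_pos_of_lt hν1 hα; positivity
  have hG := (besselFracKernel_isWeaklySingular hν1 hα).isBoundedL1Op h2 hb
  have hK := (besselResolventKernel_isWeaklySingular (lam := lam) hν1 hα).isBoundedL1Op h2 hb
  have hM := (hK.const_smul (-lam)).sum hG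
  constructor
  · have := ((hG.comp hK).sum hM).eq_zero_of_pow hb (fun n => ?_) hf
    · filter_upwards [this] with x hx
      simp only [Pi.add_apply, Pi.smul_apply, smul_eq_mul, Pi.zero_apply] at hx
      linear_combination hx
    · refine (ae_restrict_iff' measurableSet_Ioo).2 (Eventually.of_forall fun x hx => ?_)
      have := volterra_frac_resolvent_pow (σ := (n : ℂ)) hν1 hα hlam (by simp) hx.1
      simp only [Complex.cpow_natCast] at this
      simp only [Pi.add_apply, Pi.smul_apply, smul_eq_mul, Pi.zero_apply]
      linear_combination this
  · have := ((hK.comp hG).sum hM).eq_zero_of_pow hb (fun n => ?_) hf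
    · filter_upwards [this] with x hx
      simp only [Pi.add_apply, Pi.smul_apply, smul_eq_mul, Pi.zero_apply] at hx
      linear_combination hx
    · refine (ae_restrict_iff' measurableSet_Ioo).2 (Eventually.of_forall fun x hx => ?_)
      have := volterra_resolvent_frac_pow (σ := (n : ℂ)) hν1 hα hlam (by simp) hx.1
      simp only [Complex.cpow_natCast] at this
      simp only [Pi.add_apply, Pi.smul_apply, smul_eq_mul, Pi.zero_apply]
      linear_combination this

end

/-! ### Symmetry of the resolvent kernel. -/

theorem resolventBase_eq {p q t : ℝ} (hq : 0 < q) :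
    resolventBase p q t = t * (1 - t) * (p ^ 2 - q ^ 2) ^ 2 /
      (4 * ((1 - t) * q ^ 2 + t * p ^ 2)) := by
  have : (1 - (1 - p ^ 2 / q ^ 2) * t) * (4 * q ^ 2) = 4 * ((1 - t) * q ^ 2 + t * p ^ 2) := by
    field_simp
    ring
  rw [resolventBase, this]

/-- The Möbius map `s ↦ s q² / (p² (1 - s) + s q²)` is a bijection of `(0, 1)` that carries the base
for `(p, q)` to the base for `(q, p)`. Weight and Jacobian `p² q² / E²` together reproduce the
weight up to a constant, so the identity holds for every `S`, without expanding it. -/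
theorem integral_resolvent_swap (ν : ℝ) {p q : ℝ} (hp : 0 < p) (hq : 0 < q) (S : ℝ → ℂ) :
    ∫ t in Ioo (0 : ℝ) 1, S (resolventBase p q t) / (resolventWeight ν t : ℂ) =
      ((q ^ (ν - 1) * p ^ (1 - ν) : ℝ) : ℂ) *
        ∫ t in Ioo (0 : ℝ) 1, S (resolventBase q p t) / (resolventWeight ν t : ℂ) := by
  set E : ℝ → ℝ := fun s => p ^ 2 * (1 - s) + s * q ^ 2 with hE
  set m : ℝ → ℝ := fun s => s * q ^ 2 / E s with hm
  have hEpos : ∀ s ∈ Ioo (0 : ℝ) 1, 0 < E s := fun s hs => by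
    have : 0 < 1 - s := sub_pos.2 hs.2
    have := hs.1
    positivity
  have hderiv : ∀ s ∈ Ioo (0 : ℝ) 1,
      HasDerivWithinAt m (p ^ 2 * q ^ 2 / E s ^ 2) (Ioo 0 1) s := by
    intro s hs
    have h1 : HasDerivAt (fun s : ℝ => s * q ^ 2) (q ^ 2) s := by
      simpa using (hasDerivAt_id s).mul_const (q ^ 2)
    have h2 : HasDerivAt E (q ^ 2 - p ^ 2) s := by
      have := (((hasDerivAt_const s (1 : ℝ)).sub (hasDerivAt_id s)).const_mul (p ^ 2)).add h1
      convert! this using 1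
      ring
    convert! (h1.div h2 (hEpos s hs).ne').hasDerivWithinAt using 1
    congr 1
    simp only [hE]
    ring
  have hinj : InjOn m (Ioo 0 1) := by
    intro s hs t ht h
    have h1 := hEpos s hs
    have h2 := hEpos t ht
    simp only [hm] at h
    rw [div_eq_div_iff h1.ne' h2.ne'] at h
    simp only [hE] at h
    have : (s - t) * (p ^ 2 * q ^ 2) = 0 := by linear_combination h
    rcases mul_eq_zero.1 this with h | h
    · linarith
    · have : 0 < p ^ 2 * q ^ 2 := by positivity
      exact absurd h this.ne'
  have himg : m '' Ioo 0 1 = Ioo 0 1 := by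
    ext t
    simp only [mem_image]
    constructor
    · rintro ⟨s, hs, rfl⟩
      have h := hEpos s hs
      have h1 : 0 < 1 - s := sub_pos.2 hs.2
      refine ⟨div_pos (mul_pos hs.1 (by positivity)) h, ?_⟩
      rw [div_lt_one h]
      have : 0 < p ^ 2 * (1 - s) := by positivity
      simp only [hE]; linarith
    · intro ht
      have h1 : 0 < 1 - t := sub_pos.2 ht.2
      have h0 := ht.1
      have hD : 0 < q ^ 2 * (1 - t) + t * p ^ 2 := by positivity
      refine ⟨t * p ^ 2 / (q ^ 2 * (1 - t) + t * p ^ 2), ⟨by positivity, ?_⟩, ?_⟩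
      · rw [div_lt_one hD]
        have : 0 < q ^ 2 * (1 - t) := by positivity
        linarith
      · have hEe : E (t * p ^ 2 / (q ^ 2 * (1 - t) + t * p ^ 2)) =
            p ^ 2 * q ^ 2 / (q ^ 2 * (1 - t) + t * p ^ 2) := by
          simp only [hE]
          field_simp
          ring
        simp only [hm]
        rw [hEe]
        field_simp
  conv_lhs => rw [← himg]
  rw [integral_image_eq_integral_abs_deriv_smul measurableSet_Ioo hderiv hinj,
    ← integral_const_mul]
  refine setIntegral_congr_fun measurableSet_Ioo fun s hs => ?_
  have hEs := hEpos s hs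
  have h0 := hs.1
  have h1 : 0 < 1 - s := sub_pos.2 hs.2
  have hm1 : 1 - m s = p ^ 2 * (1 - s) / E s := by
    simp only [hm]
    rw [eq_div_iff hEs.ne', sub_mul, div_mul_cancel₀ _ hEs.ne']
    simp only [hE]; ring
  have hbase : resolventBase p q (m s) = resolventBase q p s := by
    rw [resolventBase_eq hq, resolventBase_eq hp, hm1]
    have e1 : p ^ 2 * (1 - s) / E s * q ^ 2 + m s * p ^ 2 = p ^ 2 * q ^ 2 / E s := by
      simp only [hm]
      field_simp
      ring
    rw [e1, show (1 - s) * p ^ 2 + s * q ^ 2 = E s by simp only [hE]; ring]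
    simp only [hm]
    field_simp
    ring
  have hw : (resolventWeight ν (m s))⁻¹ * (p ^ 2 * q ^ 2 / E s ^ 2) =
      q ^ (ν - 1) * p ^ (1 - ν) * (resolventWeight ν s)⁻¹ := by
    unfold resolventWeight
    rw [hm1]
    simp only [hm]
    have hlog : ∀ {x : ℝ}, 0 < x → ∀ s : ℝ, x ^ s = Real.exp (Real.log x * s) :=
      fun hx s => Real.rpow_def_of_pos hx s
    have hq2 : q ^ 2 = Real.exp (2 * Real.log q) := by
      rw [two_mul, Real.exp_add, Real.exp_log hq, sq]
    have hp2 : p ^ 2 = Real.exp (2 * Real.log p) := by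
      rw [two_mul, Real.exp_add, Real.exp_log hp, sq]
    have hE2 : E s ^ 2 = Real.exp (2 * Real.log (E s)) := by
      rw [two_mul, Real.exp_add, Real.exp_log hEs, sq]
    rw [hlog (by positivity : 0 < s * q ^ 2 / E s), hlog (by positivity : 0 < p ^ 2 * (1 - s) / E s),
      hlog hq, hlog hp, hlog h0, hlog h1, Real.log_div (by positivity) hEs.ne',
      Real.log_div (by positivity) hEs.ne', Real.log_mul h0.ne' (by positivity),
      Real.log_mul (by positivity) h1.ne', Real.log_pow, Real.log_pow, hq2, hp2, hE2]
    simp only [← Real.exp_add, ← Real.exp_neg, ← Real.exp_sub]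
    congr 1
    push_cast
    ring
  have hwc := congrArg (fun r : ℝ => (r : ℂ)) hw
  simp only [Complex.ofReal_mul (resolventWeight ν (m s))⁻¹,
    Complex.ofReal_mul _ (resolventWeight ν s)⁻¹, Complex.ofReal_inv (resolventWeight ν _)] at hwc
  rw [abs_of_pos (by positivity), hbase, Complex.real_smul]
  linear_combination S (resolventBase q p s) * hwc

theorem besselResolventKernel_symm (ν : ℝ) (α lam : ℂ) {p q : ℝ} (hp : 0 < p) (hq : 0 < q) :
    besselResolventKernel ν α lam p q * ((p ^ ν : ℝ) : ℂ) =
      besselResolventKernel ν α lam q p * ((q ^ ν : ℝ) : ℂ) := by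
  have h := integral_resolvent_swap ν hp hq fun z => besselWright α ν ((z : ℂ) ^ α / lam)
  have h' : ∫ t in Ioo (0 : ℝ) 1, besselResolventIntegrand ν α lam p q t =
    ((q ^ (ν - 1) * p ^ (1 - ν) : ℝ) : ℂ) *
      ∫ t in Ioo (0 : ℝ) 1, besselResolventIntegrand ν α lam q p t := h
  rw [besselResolventKernel, besselResolventKernel, h', abs_sub_comm (q ^ 2)]
  have e : 2 * q / |p ^ 2 - q ^ 2| * (q ^ (ν - 1) * p ^ (1 - ν)) * p ^ ν =
      2 * p / |p ^ 2 - q ^ 2| * q ^ ν := by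
    rw [Real.rpow_sub_one hq.ne', Real.rpow_sub hp, Real.rpow_one]
    have : 0 < p ^ ν := Real.rpow_pos_of_pos hp ν
    field_simp
  rw [← mul_assoc, ← Complex.ofReal_mul, mul_right_comm, ← Complex.ofReal_mul, e,
    Complex.ofReal_mul]
  ring

/-! ### The case `ν = 0`. -/

/-- By Weierstrass approximation, vanishing against polynomials implies vanishing against smooth
test functions. -/
theorem ae_eq_zero_of_moments_eq_zero {x : ℝ} {H : ℝ → ℂ}
    (hH : IntegrableOn H (Ioo 0 x)) (h : ∀ n : ℕ, ∫ y in Ioo 0 x, H y * (y : ℂ) ^ n = 0) :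
    ∀ᵐ y : ℝ, y ∈ Ioo 0 x → H y = 0 := by
  have hpow : ∀ n : ℕ, IntegrableOn (fun y => H y * (y : ℂ) ^ n) (Ioo 0 x) := fun n => by
    refine Integrable.mul_bdd (c := x ^ n) hH
      (Measurable.aestronglyMeasurable (by fun_prop)) ?_
    refine (ae_restrict_iff' measurableSet_Ioo).2 (Eventually.of_forall fun y hy => ?_)
    rw [norm_pow, Complex.norm_real, Real.norm_of_nonneg hy.1.le]
    exact pow_le_pow_left₀ hy.1.le hy.2.le n
  have hpoly : ∀ P : Polynomial ℝ,
      IntegrableOn (fun y => ((P.eval y : ℝ) : ℂ) * H y) (Ioo 0 x) ∧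
      ∫ y in Ioo 0 x, ((P.eval y : ℝ) : ℂ) * H y = 0 := by
    intro P
    have e : (fun y => ((P.eval y : ℝ) : ℂ) * H y) =
        fun y => ∑ i ∈ Finset.range (P.natDegree + 1), (P.coeff i : ℂ) * (H y * (y : ℂ) ^ i) := by
      ext y
      rw [Polynomial.eval_eq_sum_range]
      push_cast
      rw [Finset.sum_mul]
      exact Finset.sum_congr rfl fun i _ => by ring
    rw [e]
    refine ⟨integrable_finsetSum _ fun i _ => (hpow i).const_mul _, ?_⟩
    rw [integral_finsetSum _ fun i _ => (hpow i).const_mul _]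
    exact Finset.sum_eq_zero fun i _ => by rw [integral_const_mul, h, mul_zero]
  refine isOpen_Ioo.ae_eq_zero_of_integral_contDiff_smul_eq_zero hH.locallyIntegrableOn
    fun g hg _ hsupp => ?_
  rw [← setIntegral_eq_integral_of_forall_compl_eq_zero (s := Ioo 0 x) fun y hy => by
    rw [image_eq_zero_of_notMem_tsupport fun h' => hy (hsupp h'), zero_smul]]
  rw [← norm_le_zero_iff]
  set N := ∫ y in Ioo 0 x, ‖H y‖ with hN
  have hN0 : 0 ≤ N := integral_nonneg fun _ => norm_nonneg _
  refine le_of_forall_pos_le_add fun ε hε => ?_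
  obtain ⟨P, hP⟩ := exists_polynomial_near_of_continuousOn 0 x g hg.continuous.continuousOn
    (ε / (N + 1)) (by positivity)
  have hb : ∀ y ∈ Ioo 0 x, ‖((g y - P.eval y : ℝ) : ℂ) * H y‖ ≤ ε / (N + 1) * ‖H y‖ := by
    intro y hy
    rw [norm_mul, Complex.norm_real, Real.norm_eq_abs, abs_sub_comm]
    exact mul_le_mul_of_nonneg_right (hP y ⟨hy.1.le, hy.2.le⟩).le (norm_nonneg _)
  have hd : IntegrableOn (fun y => ((g y - P.eval y : ℝ) : ℂ) * H y) (Ioo 0 x) := by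
    refine Integrable.mono' (hH.norm.const_mul (ε / (N + 1))) ?_
      ((ae_restrict_iff' measurableSet_Ioo).2 (Eventually.of_forall hb))
    refine AEStronglyMeasurable.mul (Continuous.aestronglyMeasurable ?_) hH.aestronglyMeasurable
    have := hg.continuous
    fun_prop
  have e : ∫ y in Ioo 0 x, g y • H y = ∫ y in Ioo 0 x, ((g y - P.eval y : ℝ) : ℂ) * H y := by
    have := integral_add hd (hpoly P).1
    rw [(hpoly P).2, add_zero] at this
    rw [← this]
    refine setIntegral_congr_fun measurableSet_Ioo fun y _ => ?_
    simp only [Complex.real_smul]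
    push_cast
    ring
  rw [e, zero_add]
  calc _ ≤ ∫ y in Ioo 0 x, ‖((g y - P.eval y : ℝ) : ℂ) * H y‖ := norm_integral_le_integral_norm _
    _ ≤ ∫ y in Ioo 0 x, ε / (N + 1) * ‖H y‖ :=
        setIntegral_mono_on hd.norm (hH.norm.const_mul _) measurableSet_Ioo hb
    _ = ε / (N + 1) * N := integral_const_mul _ _
    _ ≤ ε := by rw [div_mul_eq_mul_div, div_le_iff₀ (by positivity)]; nlinarith

/-- At `ν = 0` the Gamma functions pair up with arguments differing by `1/2`, and Legendre's
duplication formula applies to numerator and denominator. -/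
theorem besselMomentCoeff_zero {β : ℂ} (hβ : 0 < β.re) (n : ℕ) :
    besselMomentCoeff 0 β n = Complex.Gamma (n + 1) / Complex.Gamma (n + 1 + 2 * β) := by
  have h1 := Complex.Gamma_mul_Gamma_add_half (((n : ℂ) + 1) / 2)
  have h2 := Complex.Gamma_mul_Gamma_add_half (((n : ℂ) + 1) / 2 + β)
  have hG : Complex.Gamma (n + 1 + 2 * β) ≠ 0 := Complex.Gamma_ne_zero_of_re_pos (by
    simp; positivity)
  have hpi : ((√Real.pi : ℝ) : ℂ) ≠ 0 := by
    exact_mod_cast (Real.sqrt_pos.2 Real.pi_pos).ne'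
  rw [besselMomentCoeff, Complex.ofReal_zero, sub_zero, h1, add_right_comm _ (1 / 2) β, h2,
    show 2 * (((n : ℂ) + 1) / 2) = n + 1 by ring,
    show 2 * (((n : ℂ) + 1) / 2 + β) = n + 1 + 2 * β by ring,
    show 1 - ((n : ℂ) + 1 + 2 * β) = (1 - (n + 1)) + -(2 * β) by ring,
    Complex.cpow_add _ _ two_ne_zero]
  have h3 : (2 : ℂ) ^ (1 - ((n : ℂ) + 1)) ≠ 0 := by simp [Complex.cpow_eq_zero_iff]
  have h4 : (2 : ℂ) ^ (-(2 * β)) ≠ 0 := by simp [Complex.cpow_eq_zero_iff]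
  field_simp

/-- No closed form of `₂F₁` is used: both sides have the same moments in `y` on `(0, x)`, hence
agree almost everywhere, and both are continuous there. -/
theorem besselFracKernel_zero {β : ℂ} (hβ : 1 / 2 < β.re) {x y : ℝ} (hy : 0 < y) (hyx : y < x) :
    besselFracKernel 0 β y x = ((x - y : ℝ) : ℂ) ^ (2 * β - 1) / Complex.Gamma (2 * β) := by
  have hx := hy.trans hyx
  have hβ' : (1 - (0 : ℝ)) / 2 < β.re := by linarith
  have hβ0 : 0 < β.re := by linarith
  have h2β : 0 < (2 * β).re := by simpa using hβ0
  have hG := Complex.Gamma_ne_zero_of_re_pos h2β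
  have hgi : ∀ n : ℕ, IntegrableOn
      (fun y => besselFracKernel 0 β y x * (y : ℂ) ^ (n : ℂ)) (Ioo 0 x) := by
    intro n
    obtain ⟨_, _, hg⟩ := neumannTerm_mul_pow_bound (ν := 0) (α := β) (lam := 1) (σ := (n : ℂ))
      one_pos hβ' (by simp) (add_pos hx one_pos)
    simpa only [neumannTerm, one_pow, inv_one, one_mul, zero_add, Nat.cast_one, mul_one]
      using (hg 0 x hx (lt_add_one x)).1
  have hri : ∀ n : ℕ, IntegrableOn (fun y => ((x - y : ℝ) : ℂ) ^ (2 * β - 1) /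
      Complex.Gamma (2 * β) * (y : ℂ) ^ (n : ℂ)) (Ioo 0 x) := by
    intro n
    have := (scaled_beta_integrableOn (u := (n : ℂ) + 1) (v := 2 * β) (by simp; positivity)
      h2β hx).mul_const (Complex.Gamma (2 * β))⁻¹
    refine this.congr (Eventually.of_forall fun y => ?_)
    simp only [add_sub_cancel_right]
    ring
  set H : ℝ → ℂ := fun y => besselFracKernel 0 β y x -
    ((x - y : ℝ) : ℂ) ^ (2 * β - 1) / Complex.Gamma (2 * β) with hH
  have hHi : IntegrableOn H (Ioo 0 x) := by
    have := (hgi 0).sub (hri 0)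
    refine this.congr (Eventually.of_forall fun y => ?_)
    simp [hH]
  have hmom : ∀ n : ℕ, ∫ y in Ioo 0 x, H y * (y : ℂ) ^ n = 0 := by
    intro n
    have h1 := besselFracKernel_moment (ν := 0) (σ := (n : ℂ)) one_pos hβ0 (by simp) hx
    have h2 := scaled_beta_integral (u := (n : ℂ) + 1) (v := 2 * β) (by simp; positivity) h2β hx
    have h3 : ∫ y in Ioo 0 x, ((x - y : ℝ) : ℂ) ^ (2 * β - 1) / Complex.Gamma (2 * β) *
        (y : ℂ) ^ (n : ℂ) = besselMomentCoeff 0 β n * (x : ℂ) ^ ((n : ℂ) + 2 * β) := by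
      rw [besselMomentCoeff_zero hβ0, show (n : ℂ) + 2 * β = n + 1 + 2 * β - 1 by ring]
      rw [add_sub_cancel_right] at h2
      calc _ = ∫ y in Ioo 0 x, (Complex.Gamma (2 * β))⁻¹ *
            ((y : ℂ) ^ (n : ℂ) * ((x - y : ℝ) : ℂ) ^ (2 * β - 1)) := by
              congr 1; ext y; ring
        _ = _ := by rw [integral_const_mul, h2]; field_simp
    have h4 := integral_sub (hgi n) (hri n)
    rw [h1, h3, sub_self] at h4
    rw [← h4]
    congr 1
    ext y
    simp only [hH, Complex.cpow_natCast]
    ring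
  have hae := ae_eq_zero_of_moments_eq_zero hHi hmom
  have hc1 : ContinuousOn (fun y => besselFracKernel 0 β y x) (Ioo 0 x) :=
    (besselFracKernel_continuousOn one_pos hβ').comp (f := fun y => (x, y)) (by fun_prop)
      fun y hy => hy
  have hc2 : ContinuousOn (fun y : ℝ => ((x - y : ℝ) : ℂ) ^ (2 * β - 1) /
      Complex.Gamma (2 * β)) (Ioo 0 x) := by
    refine ContinuousOn.div_const (ContinuousOn.cpow (by fun_prop) continuousOn_const ?_) _
    exact fun y hy => Complex.ofReal_mem_slitPlane.2 (sub_pos.2 hy.2)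
  refine Measure.eqOn_open_of_ae_eq (μ := volume) ?_ isOpen_Ioo hc1 hc2 ⟨hy, hyx⟩
  refine (ae_restrict_iff' measurableSet_Ioo).2 ?_
  filter_upwards [hae] with y hy hmem
  exact sub_eq_zero.1 (hy hmem)

theorem besselResolventKernel_zero {α lam : ℂ} (hα : 1 / 2 < α.re) {x y : ℝ}
    (hy : 0 < y) (hyx : y < x) :
    besselResolventKernel 0 α lam y x = (1 / lam) * ((x - y : ℝ) : ℂ) ^ (2 * α - 1) *
      mittagLeffler (2 * α) (2 * α) (((x - y : ℝ) : ℂ) ^ (2 * α) / lam) := by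
  have hα' : (1 - (0 : ℝ)) / 2 < α.re := by linarith
  have hd : ((x - y : ℝ) : ℂ) ≠ 0 := by exact_mod_cast (sub_pos.2 hyx).ne'
  rw [← (besselResolventKernel_hasSum one_pos hα' hy hyx).tsum_eq, mittagLeffler, ← tsum_mul_left]
  refine tsum_congr fun n => ?_
  have hn := lt_re_mul_succ one_pos hα' n
  rw [neumannTerm, besselFracKernel_zero (by linarith) hy hyx, div_pow, ← Complex.cpow_mul_nat,
    show 2 * α * n + 2 * α = 2 * (α * (n + 1 : ℕ)) by push_cast; ring,
    show 2 * (α * (n + 1 : ℕ)) - 1 = 2 * α - 1 + 2 * α * n by push_cast; ring,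
    Complex.cpow_add _ _ hd, pow_succ]
  ring

/-! ### Resolvents on the half-line and conjugation by the power weight. -/

/-- A property that holds almost everywhere on every `(0, b)` holds almost everywhere on
`(0, ∞)`. -/
theorem ae_Ioi_of_forall_Ioo {P : ℝ → Prop}
    (h : ∀ b : ℝ, 0 < b → ∀ᵐ x ∂(volume.restrict (Ioo 0 b)), P x) :
    ∀ᵐ x ∂(volume.restrict (Ioi (0 : ℝ))), P x := by
  have e : Ioi (0 : ℝ) = ⋃ n : ℕ, Ioo (0 : ℝ) (n + 1) := by
    ext x
    simp only [mem_Ioi, mem_iUnion, mem_Ioo]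
    constructor
    · intro hx
      obtain ⟨n, hn⟩ := exists_nat_gt x
      exact ⟨n, hx, by linarith⟩
    · rintro ⟨n, hx, -⟩; exact hx
  rw [e, ae_restrict_iUnion_iff]
  exact fun n => h _ (by positivity)

theorem mem_locIntegrableSpace_zero {f : ℝ → ℂ} :
    f ∈ locIntegrableSpace 0 ↔ ∀ b : ℝ, 0 < b → IntegrableOn f (Ioo 0 b) := by
  simp [locIntegrableSpace]

section

variable {e : ℝ} {g k : ℝ → ℝ → ℂ} {lam : ℂ}

theorem convergesAE_of_isWeaklySingular (he : 0 < e) (hg : IsWeaklySingular e g) {f : ℝ → ℂ}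
    (hf : f ∈ locIntegrableSpace 0) : ConvergesAE g f :=
  ae_Ioi_of_forall_Ioo fun b hb =>
    hg.ae_integrableOn he hb (mem_locIntegrableSpace_zero.1 hf b hb)

theorem resolventForm_eq (f : ℝ → ℂ) :
    resolventForm lam k f = (-(1 / lam)) • f + (-(1 / lam)) • volterra k f := by
  ext x
  simp only [resolventForm, Pi.add_apply, Pi.smul_apply, smul_eq_mul, volterra]
  ring

/-- With `GK = KG = lam K - G`, expanding `(G - lam)(I + K)` and `(I + K)(G - lam)` leaves only
`-lam I`. -/
theorem isResolventAt_volterra (he : 0 < e) (hg : IsWeaklySingular e g)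
    (hk : IsWeaklySingular e k) (hlam : lam ≠ 0)
    (hres : ∀ b : ℝ, 0 < b → ∀ f : ℝ → ℂ, IntegrableOn f (Ioo 0 b) →
      (∀ᵐ x ∂(volume.restrict (Ioo 0 b)), volterra g (volterra k f) x =
        lam * volterra k f x - volterra g f x) ∧
      (∀ᵐ x ∂(volume.restrict (Ioo 0 b)), volterra k (volterra g f) x =
        lam * volterra k f x - volterra g f x)) :
    IsResolventAt (locIntegrableSpace 0) (volterra g) lam (resolventForm lam k) := by
  have hG := fun b hb => hg.isBoundedL1Op (b := b) he hb
  have hK := fun b hb => hk.isBoundedL1Op (b := b) he hb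
  refine ⟨fun f hf => ?_, fun f hf => ?_, fun f hf => ?_, fun f hf => ?_⟩ <;>
    rw [mem_locIntegrableSpace_zero] at hf
  · exact mem_locIntegrableSpace_zero.2 fun b hb => (hG b hb).maps f (hf b hb)
  · rw [resolventForm_eq]
    exact mem_locIntegrableSpace_zero.2 fun b hb =>
      ((hf b hb).smul _).add (((hK b hb).maps f (hf b hb)).smul _)
  · refine ae_Ioi_of_forall_Ioo fun b hb => ?_
    have hfb := hf b hb
    have hkf := (hK b hb).maps f hfb
    rw [resolventForm_eq]
    filter_upwards [(hG b hb).add _ _ (hfb.smul (-(1 / lam))) (hkf.smul (-(1 / lam))),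
      (hG b hb).smul (-(1 / lam)) f, (hG b hb).smul (-(1 / lam)) (volterra k f),
      (hres b hb f hfb).1] with x h1 h2 h3 h4
    rw [h1, Pi.add_apply, h2, h3]
    simp only [Pi.add_apply, Pi.smul_apply, smul_eq_mul]
    rw [h4]
    field_simp
    ring
  · refine ae_Ioi_of_forall_Ioo fun b hb => ?_
    have hfb := hf b hb
    have hgf := (hG b hb).maps f hfb
    have es : (fun x => volterra g f x - lam * f x) = volterra g f + (-lam) • f := by
      ext x; simp [sub_eq_add_neg]
    rw [resolventForm_eq, es]
    filter_upwards [(hK b hb).add _ _ hgf (hfb.smul (-lam)), (hK b hb).smul (-lam) f,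
      (hres b hb f hfb).2] with x h1 h2 h3
    simp only [Pi.add_apply, Pi.smul_apply, smul_eq_mul] at h1 h2 ⊢
    rw [h1, h2, h3]
    field_simp
    ring

end

section

variable {ν : ℝ} {g g' k k' : ℝ → ℝ → ℂ} {lam : ℂ}

theorem mem_locIntegrableSpace_iff {f : ℝ → ℂ} :
    f ∈ locIntegrableSpace ν ↔ (fun y => ((y ^ ν : ℝ) : ℂ) * f y) ∈ locIntegrableSpace 0 := by
  rw [mem_locIntegrableSpace_zero]
  rfl

theorem rpow_ofReal_ne_zero {x : ℝ} (hx : 0 < x) : ((x ^ ν : ℝ) : ℂ) ≠ 0 := by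
  exact_mod_cast (Real.rpow_pos_of_pos hx ν).ne'

theorem convergesAE_conj (hgg : ∀ x y, 0 < y → y < x →
    g' x y * ((x ^ ν : ℝ) : ℂ) = g x y * ((y ^ ν : ℝ) : ℂ)) {f : ℝ → ℂ}
    (h : ConvergesAE g fun y => ((y ^ ν : ℝ) : ℂ) * f y) : ConvergesAE g' f := by
  filter_upwards [h, ae_restrict_mem measurableSet_Ioi] with x hx hx0
  refine IntegrableOn.congr_fun (hx.const_mul ((x ^ ν : ℝ) : ℂ)⁻¹) (fun y hy => ?_)
    measurableSet_Ioo
  have := rpow_ofReal_ne_zero (ν := ν) hx0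
  rw [inv_mul_eq_iff_eq_mul₀ this]
  linear_combination (-f y) * hgg x y hy.1 hy.2

theorem volterra_conj (hgg : ∀ x y, 0 < y → y < x →
    g' x y * ((x ^ ν : ℝ) : ℂ) = g x y * ((y ^ ν : ℝ) : ℂ)) (f : ℝ → ℂ) (x : ℝ) :
    ((x ^ ν : ℝ) : ℂ) * volterra g' f x = volterra g (fun y => ((y ^ ν : ℝ) : ℂ) * f y) x := by
  rw [volterra, volterra, ← integral_const_mul]
  refine setIntegral_congr_fun measurableSet_Ioo fun y hy => ?_
  linear_combination f y * hgg x y hy.1 hy.2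

theorem resolventForm_conj (hkk : ∀ x y, 0 < y → y < x →
    k' x y * ((x ^ ν : ℝ) : ℂ) = k x y * ((y ^ ν : ℝ) : ℂ)) (f : ℝ → ℂ) (x : ℝ) :
    ((x ^ ν : ℝ) : ℂ) * resolventForm lam k' f x =
      resolventForm lam k (fun y => ((y ^ ν : ℝ) : ℂ) * f y) x := by
  have := volterra_conj hkk f x
  simp only [volterra] at this
  simp only [resolventForm]
  linear_combination (-(1 / lam)) * this

/-- Multiplication by `y^ν` identifies the weighted space with the unweighted one and intertwines
the primed operators with the unprimed ones. -/
theorem isResolventAt_conj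
    (hgg : ∀ x y, 0 < y → y < x → g' x y * ((x ^ ν : ℝ) : ℂ) = g x y * ((y ^ ν : ℝ) : ℂ))
    (hkk : ∀ x y, 0 < y → y < x → k' x y * ((x ^ ν : ℝ) : ℂ) = k x y * ((y ^ ν : ℝ) : ℂ))
    (h : IsResolventAt (locIntegrableSpace 0) (volterra g) lam (resolventForm lam k)) :
    IsResolventAt (locIntegrableSpace ν) (volterra g') lam (resolventForm lam k') := by
  obtain ⟨h1, h2, h3, h4⟩ := h
  refine ⟨fun f hf => ?_, fun f hf => ?_, fun f hf => ?_, fun f hf => ?_⟩ <;>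
    rw [mem_locIntegrableSpace_iff] at hf
  · rw [mem_locIntegrableSpace_iff]
    simp_rw [volterra_conj hgg]
    exact h1 _ hf
  · rw [mem_locIntegrableSpace_iff]
    simp_rw [resolventForm_conj hkk]
    exact h2 _ hf
  · filter_upwards [h3 _ hf, ae_restrict_mem measurableSet_Ioi] with x hx hx0
    refine mul_left_cancel₀ (rpow_ofReal_ne_zero (ν := ν) hx0) ?_
    rw [mul_sub, mul_left_comm, volterra_conj hgg, resolventForm_conj hkk]
    simp_rw [resolventForm_conj hkk]
    exact hx
  · filter_upwards [h4 _ hf, ae_restrict_mem measurableSet_Ioi] with x hx hx0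
    refine mul_left_cancel₀ (rpow_ofReal_ne_zero (ν := ν) hx0) ?_
    rw [resolventForm_conj hkk]
    simp_rw [mul_sub, mul_left_comm _ lam, volterra_conj hgg]
    exact hx

end

theorem theorem9 (ν : ℝ) (hν0 : 0 ≤ ν) (hν1 : ν < 1) (α : ℂ) (hα : (1 - ν) / 2 < α.re)
    (lam : ℂ) (hlam : lam ≠ 0) :
    -- the series and the integral that define the kernel converge
    (∀ z : ℂ, Summable fun k : ℕ => besselWrightTerm α ν z (k + 1)) ∧
    (∀ p q : ℝ, 0 < p → 0 < q → p ≠ q →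
      IntegrableOn (besselResolventIntegrand ν α lam p q) (Ioo 0 1)) ∧
    -- the resolvent of the operator with the kernel `G(y, x)`
    (∀ f ∈ locIntegrableSpace 0,
      ConvergesAE (fun x y => besselFracKernel ν α y x) f ∧
      ConvergesAE (fun x y => besselResolventKernel ν α lam y x) f) ∧
    IsResolventAt (locIntegrableSpace 0) (besselFracIntLeft ν α 0) lam
      (resolventForm lam fun x y => besselResolventKernel ν α lam y x) ∧
    -- the resolvent of the operator with the kernel `G(x, y)`
    (∀ f ∈ locIntegrableSpace ν,
      ConvergesAE (fun x y => besselFracKernel ν α x y) f ∧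
      ConvergesAE (fun x y => besselResolventKernel ν α lam x y) f) ∧
    IsResolventAt (locIntegrableSpace ν) (besselFracIntLeft' ν α 0) lam
      (resolventForm lam fun x y => besselResolventKernel ν α lam x y) ∧
    -- for `ν = 0` this is the formula for Riemann-Liouville integrals of order `2α`
    (ν = 0 → ∀ x y : ℝ, 0 < y → y < x →
      besselFracKernel ν α y x = ((x - y : ℝ) : ℂ) ^ (2 * α - 1) / Complex.Gamma (2 * α) ∧
      besselFracKernel ν α x y = ((x - y : ℝ) : ℂ) ^ (2 * α - 1) / Complex.Gamma (2 * α) ∧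
      besselResolventKernel ν α lam y x = (1 / lam) * ((x - y : ℝ) : ℂ) ^ (2 * α - 1) *
        mittagLeffler (2 * α) (2 * α) (((x - y : ℝ) : ℂ) ^ (2 * α) / lam) ∧
      besselResolventKernel ν α lam x y = (1 / lam) * ((x - y : ℝ) : ℂ) ^ (2 * α - 1) *
        mittagLeffler (2 * α) (2 * α) (((x - y : ℝ) : ℂ) ^ (2 * α) / lam)) := by
  have h0 := re_pos_of_lt hν1 hα
  have h2 : 0 < 2 * α.re := by positivity
  have hG := besselFracKernel_isWeaklySingular hν1 hα
  have hK := besselResolventKernel_isWeaklySingular (lam := lam) hν1 hα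
  have hGs : ∀ x y : ℝ, 0 < y → y < x → besselFracKernel ν α x y * ((x ^ ν : ℝ) : ℂ) =
      besselFracKernel ν α y x * ((y ^ ν : ℝ) : ℂ) := fun x y hy hyx =>
    besselFracKernel_symm h0 (hy.trans hyx) hy hyx.ne'
  have hKs : ∀ x y : ℝ, 0 < y → y < x → besselResolventKernel ν α lam x y * ((x ^ ν : ℝ) : ℂ) =
      besselResolventKernel ν α lam y x * ((y ^ ν : ℝ) : ℂ) := fun x y hy hyx =>
    besselResolventKernel_symm ν α lam (hy.trans hyx) hy
  have hres : IsResolventAt (locIntegrableSpace 0)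
      (volterra fun x y => besselFracKernel ν α y x) lam
      (resolventForm lam fun x y => besselResolventKernel ν α lam y x) :=
    isResolventAt_volterra h2 hG hK hlam fun b hb f hf => resolvent_identities hν1 hα hlam hb hf
  refine ⟨besselWrightTerm_summable hν1 hα,
    fun p q hp hq hpq => besselResolventIntegrand_integrableOn hν1 hα hp hq hpq,
    fun f hf => ⟨convergesAE_of_isWeaklySingular h2 hG hf, convergesAE_of_isWeaklySingular h2 hK hf⟩,
    hres,
    fun f hf => ⟨convergesAE_conj hGs (convergesAE_of_isWeaklySingular h2 hG
        (mem_locIntegrableSpace_iff.1 hf)),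
      convergesAE_conj hKs (convergesAE_of_isWeaklySingular h2 hK
        (mem_locIntegrableSpace_iff.1 hf))⟩,
    isResolventAt_conj hGs hKs hres, ?_⟩
  rintro rfl x y hy hyx
  have hα' : 1 / 2 < α.re := by linarith
  have e1 := hGs x y hy hyx
  have e2 := hKs x y hy hyx
  -- At `ν = 0` the weights are `1`, so the intertwining relations say that both kernels are
  -- symmetric.
  simp only [Real.rpow_zero, Complex.ofReal_one, mul_one] at e1 e2
  rw [e1, e2, besselFracKernel_zero hα' hy hyx, besselResolventKernel_zero hα' hy hyx]
  exact ⟨rfl, rfl, rfl, rfl⟩
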